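/- **Setting.** Let $d\ge 1$, let $\Omega\subset\mathbb{R}^d$ be a bounded open set (for instance a bounded Lipschitz polytopal domain, $d\in\{1,2,3\}$), $T>0$ and $Q_T=\Omega\times(0,T)$. Let $c\in L^\infty(\Omega)$ with $c\ge c_0>0$ a.e. in $\Omega$. Put $$(f,g)_{L^2_e(Q_T)}=\int_{Q_T} f(x,t)\cdot g(x,t)\,e^{-t/T}\,dx\,dt,\qquad \|f\|_{L^2_e(Q_T)}^2=(f,f)_{L^2_e(Q_T)} .$$ Let $S_{h_x}\subset H^1_0(\Omega)$ and $S_{h_t}\subset H^1_{0,\bullet}(0,T)=\{u\in H^1(0,T):u(0)=0\}$ be arbitrary finite-dimensional subspaces, and set $Q_h=S_{h_x}\otimes S_{h_t}$ and $\partial_tQ_h=S_{h_x}\otimes\partial_tS_{h_t}$. For $U,V\in Q_h$ and $\lambda,\chi\in\partial_tQ_h$ let $$\mathcal A((U,V),(\lambda,\chi))=(\partial_tV,\lambda)_{L^2_e(Q_T)}+(c^2\nabla_xU,\nabla_x\lambda)_{L^2_e(Q_T)}-(\partial_tU,\chi)_{L^2_e(Q_T)}+(V,\chi)_{L^2_e(Q_T)}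 .$$ For $U_0\in H^1_0(\Omega)$, $V_0\in L^2(\Omega)$ and $F\in L^2(Q_T)$ the discrete problem is: find $(U_h,V_h)\in Q_h\times Q_h$ such that for all $(\lambda,\chi)\in\partial_tQ_h\times\partial_tQ_h$ $$\mathcal A((U_h,V_h),(\lambda,\chi))=(F,\lambda)_{L^2_e(Q_T)}-(c^2\nabla_xU_0,\nabla_x\lambda)_{L^2_e(Q_T)}-(V_0,\chi)_{L^2_e(Q_T)}.\tag{1}$$ For $W\in L^2(Q_T)$ the discrete Newton potential $\mathcal N_hW\in S_{h_x}\otimes L^2(0,T)$ is defined by $(c^2\nabla_x\mathcal N_hW,\nabla_xZ)_{L^2_e(Q_T)}=(W,Z)_{L^2_e(Q_T)}$ for all $Z\in S_{h_x}\otimes L^2(0,T)$, and $$\|(U,V)\|_{\mathcal V_{e,h}}^2=\|\partial_tU\|_{L^2_e(Q_T)}^2+\|c\nabla_x\mathcal N_h\partial_tV\|_{L^2_e(Q_T)}^2+\|c\nabla_xU\|_{L^2_e(Q_T)}^2+\|V\|_{L^2_e(Q_T)}^2 .$$ **Claim.** Problem (1) has a unique solution $(U_h,V_h)$. If moreover $V_0\in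 H^1_0(\Omega)$ and $\nabla_x\cdot(c^2\nabla_xU_0)\in L^2(\Omega)$, and if $C_\Omega>0$ is a constant in the Poincaré inequality $\|v\|_{L^2(\Omega)}\le C_\Omega\|\nabla_xv\|_{L^2(\Omega)}$ for all $v\in H^1_0(\Omega)$, then $$\|(U_h,V_h)\|_{\mathcal V_{e,h}}\le 2\sqrt{C_\Omega^2/c_0^2+4T^2}\,\Bigl(\|F\|_{L^2_e(Q_T)}+\sqrt T\,\|\nabla_x\cdot(c^2\nabla_xU_0)\|_{L^2(\Omega)}+\sqrt T\,\|c\nabla_xV_0\|_{L^2(\Omega)}\Bigr).$$ There is no restriction on the discrete spaces (on $h_t$ or $h_x$) besides the above. -/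

import Mathlib

open MeasureTheory Set
open scoped ContDiff ENNReal TensorProduct

noncomputable section

namespace WaveDisc

/-! ## Lebesgue spaces on the space domain, the time interval and the cylinder -/

/-- Euclidean space `ℝ^d`. -/
abbrev Sp (d : ℕ) : Type := EuclideanSpace ℝ (Fin d)

/-- Lebesgue measure on the space domain `Ω`. -/
abbrev muS {d : ℕ} (Ω : Set (Sp d)) : Measure (Sp d) := volume.restrict Ω

/-- Lebesgue measure on the time interval `(0, T)`. -/
abbrev muT (T : ℝ) : Measure ℝ := volume.restrict (Ioo 0 T)

/-- Lebesgue measure on the space-time cylinder `Q_T = Ω × (0, T)`. -/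
abbrev muQ {d : ℕ} (Ω : Set (Sp d)) (T : ℝ) : Measure (Sp d × ℝ) := (muS Ω).prod (muT T)

/-- `L²(Ω)`. -/
abbrev L2S {d : ℕ} (Ω : Set (Sp d)) : Type := Lp ℝ 2 (muS Ω)

/-- `L²(Ω)^d`. -/
abbrev L2SVec {d : ℕ} (Ω : Set (Sp d)) : Type := Lp (Sp d) 2 (muS Ω)

/-- `L²(0, T)`. -/
abbrev L2T (T : ℝ) : Type := Lp ℝ 2 (muT T)

/-- `L²(Q_T)`. -/
abbrev L2Q {d : ℕ} (Ω : Set (Sp d)) (T : ℝ) : Type := Lp ℝ 2 (muQ Ω T)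

/-- `L²(Q_T)^d`. -/
abbrev L2QVec {d : ℕ} (Ω : Set (Sp d)) (T : ℝ) : Type := Lp (Sp d) 2 (muQ Ω T)

/-- The `L²(Ω)` norm of a (scalar or vector valued) function. -/
def normS {d : ℕ} {E : Type*} [NormedAddCommGroup E] (Ω : Set (Sp d)) (f : Sp d → E) : ℝ :=
  Real.sqrt (∫ x, ‖f x‖ ^ 2 ∂(muS Ω))

/-- The weighted scalar product
`(f, g)_{L²_e(Q_T)} = ∫_{Q_T} f(x,t) · g(x,t) e^{-t/T} dx dt`. -/
def ipE {d : ℕ} {E : Type*} [NormedAddCommGroup E] [InnerProductSpace ℝ E]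
    (Ω : Set (Sp d)) (T : ℝ) (f g : Sp d × ℝ → E) : ℝ :=
  ∫ z, inner ℝ (f z) (g z) * Real.exp (-z.2 / T) ∂(muQ Ω T)

/-- The weighted norm `‖f‖_{L²_e(Q_T)}`. -/
def normE {d : ℕ} {E : Type*} [NormedAddCommGroup E] [InnerProductSpace ℝ E]
    (Ω : Set (Sp d)) (T : ℝ) (f : Sp d × ℝ → E) : ℝ :=
  Real.sqrt (ipE Ω T f f)

/-! ## Sobolev spaces -/

/-- Test functions: `φ ∈ C_c^∞(Ω)`. -/
def IsTest {d : ℕ} (Ω : Set (Sp d)) (φ : Sp d → ℝ) : Prop :=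
  ContDiff ℝ ∞ φ ∧ HasCompactSupport φ ∧ tsupport φ ⊆ Ω

/-- `H¹₀(Ω)`, the closure of `C_c^∞(Ω)` in the `H¹` norm. An element `u` of `H¹₀(Ω)` is represented
by the pair `(u, ∇u) ∈ L²(Ω) × L²(Ω)^d` (the weak gradient `∇u` is determined by `u`), so that the
`H¹` topology is the one of the product. -/
def H10 {d : ℕ} (Ω : Set (Sp d)) : Submodule ℝ (L2S Ω × L2SVec Ω) :=
  (Submodule.span ℝ {p : L2S Ω × L2SVec Ω | ∃ φ : Sp d → ℝ, IsTest Ω φ ∧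
    p.1 =ᵐ[muS Ω] φ ∧ p.2 =ᵐ[muS Ω] gradient φ}).topologicalClosure

/-- `g = ∇ · f` in the sense of distributions on `Ω`. -/
def IsWeakDiv {d : ℕ} (Ω : Set (Sp d)) (f : Sp d → Sp d) (g : Sp d → ℝ) : Prop :=
  ∀ φ : Sp d → ℝ, IsTest Ω φ →
    ∫ x, g x * φ x ∂(muS Ω) = -∫ x, inner ℝ (f x) (gradient φ x) ∂(muS Ω)

/-- `C` is a constant in the Poincaré inequality
`‖v‖_{L²(Ω)} ≤ C ‖∇v‖_{L²(Ω)}`, `v ∈ H¹₀(Ω)`. -/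
def IsPoincareConst {d : ℕ} (Ω : Set (Sp d)) (C : ℝ) : Prop :=
  0 < C ∧ ∀ v ∈ H10 Ω, normS Ω v.1 ≤ C * normS Ω v.2

theorem intervalIntegrable_coe {T : ℝ} (g : L2T T) {t : ℝ} (ht : t ∈ Ioo 0 T) :
    IntervalIntegrable (g : ℝ → ℝ) volume 0 t := by
  have h1 : Integrable (g : ℝ → ℝ) (muT T) :=
    (Lp.memLp g).integrable (by norm_num)
  rw [intervalIntegrable_iff_integrableOn_Ioc_of_le ht.1.le]
  have h2 : IntegrableOn (g : ℝ → ℝ) (Ioo 0 T) volume := h1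
  exact h2.mono_set (fun s hs => ⟨hs.1, hs.2.trans_lt ht.2⟩)

theorem intervalIntegral_congr_coe {T t : ℝ} (ht : t ∈ Ioo 0 T) {f g : ℝ → ℝ}
    (h : f =ᵐ[muT T] g) : ∫ s in (0 : ℝ)..t, f s = ∫ s in (0 : ℝ)..t, g s := by
  rw [intervalIntegral.integral_of_le ht.1.le, intervalIntegral.integral_of_le ht.1.le]
  refine integral_congr_ae (h.filter_mono (ae_mono (Measure.restrict_mono ?_ le_rfl)))
  exact fun s hs => ⟨hs.1, hs.2.trans_lt ht.2⟩

/-- `H¹_{0,•}(0,T) = {u ∈ H¹(0,T) : u(0) = 0}`: the functions `u ∈ L²(0,T)` that are absolutely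
continuous with derivative `u' ∈ L²(0,T)` and vanish at `0`, i.e. `u(t) = ∫_0^t u'(s) ds`.
An element `u` is represented by the pair `(u, u')`. -/
def H1Zero (T : ℝ) : Submodule ℝ (L2T T × L2T T) where
  carrier := {p | ∀ᵐ t ∂(muT T), p.1 t = ∫ s in (0 : ℝ)..t, p.2 s}
  zero_mem' := by
    simp only [Set.mem_ofPred_eq, Prod.fst_zero, Prod.snd_zero]
    filter_upwards [Lp.coeFn_zero ℝ 2 (muT T), ae_restrict_mem measurableSet_Ioo] with t h ht
    rw [h, intervalIntegral_congr_coe ht (Lp.coeFn_zero ℝ 2 (muT T))]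
    simp
  add_mem' := by
    intro p q hp hq
    simp only [Set.mem_ofPred_eq, Prod.fst_add, Prod.snd_add] at hp hq ⊢
    filter_upwards [hp, hq, Lp.coeFn_add p.1 q.1, ae_restrict_mem measurableSet_Ioo]
      with t h1 h2 h3 ht
    rw [h3, Pi.add_apply, h1, h2, intervalIntegral_congr_coe ht (Lp.coeFn_add p.2 q.2),
      ← intervalIntegral.integral_add (intervalIntegrable_coe _ ht) (intervalIntegrable_coe _ ht)]
    rfl
  smul_mem' := by
    intro a p hp
    simp only [Set.mem_ofPred_eq, Prod.smul_fst, Prod.smul_snd] at hp ⊢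
    filter_upwards [hp, Lp.coeFn_smul a p.1, ae_restrict_mem measurableSet_Ioo] with t h1 h3 ht
    rw [h3, Pi.smul_apply, h1, intervalIntegral_congr_coe ht (Lp.coeFn_smul a p.2)]
    simp [intervalIntegral.integral_const_mul]

/-! ## Space-time products and tensor product spaces -/

theorem memLp_prod {α β E : Type*} [MeasurableSpace α] [MeasurableSpace β] {μ : Measure α}
    {ν : Measure β} [SFinite μ] [SFinite ν] [NormedAddCommGroup E] [NormedSpace ℝ E]
    (f : Lp E 2 μ) (g : Lp ℝ 2 ν) :
    MemLp (fun z : α × β => g z.2 • f z.1) 2 (μ.prod ν) := by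
  have hm : AEStronglyMeasurable (fun z : α × β => g z.2 • f z.1) (μ.prod ν) :=
    ((Lp.aestronglyMeasurable g).comp_snd).smul ((Lp.aestronglyMeasurable f).comp_fst)
  rw [← memLp_norm_iff hm, memLp_two_iff_integrable_sq hm.norm]
  have hf : Integrable (fun x => ‖f x‖ ^ 2) μ :=
    (memLp_two_iff_integrable_sq (Lp.aestronglyMeasurable f).norm).1 (Lp.memLp f).norm
  have hg : Integrable (fun x => ‖g x‖ ^ 2) ν :=
    (memLp_two_iff_integrable_sq (Lp.aestronglyMeasurable g).norm).1 (Lp.memLp g).norm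
  refine (hf.mul_prod hg).congr (Filter.Eventually.of_forall fun z => ?_)
  simp only [norm_smul]
  ring

theorem ae_comp_fst {α β : Type*} [MeasurableSpace α] [MeasurableSpace β] {μ : Measure α}
    {ν : Measure β} [SFinite μ] [SFinite ν] {p : α → Prop} (h : ∀ᵐ x ∂μ, p x) :
    ∀ᵐ z ∂(μ.prod ν), p z.1 :=
  Measure.quasiMeasurePreserving_fst.ae h

theorem ae_comp_snd {α β : Type*} [MeasurableSpace α] [MeasurableSpace β] {μ : Measure α}
    {ν : Measure β} [SFinite μ] [SFinite ν] {p : β → Prop} (h : ∀ᵐ x ∂ν, p x) :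
    ∀ᵐ z ∂(μ.prod ν), p z.2 :=
  Measure.quasiMeasurePreserving_snd.ae h

/-- The bilinear map sending `f = f(x)` and `g = g(t)` to the function `(x, t) ↦ g(t) f(x)`. -/
def prodLp {α β E : Type*} [MeasurableSpace α] [MeasurableSpace β] (μ : Measure α)
    (ν : Measure β) [SFinite μ] [SFinite ν] [NormedAddCommGroup E] [NormedSpace ℝ E] :
    Lp E 2 μ →ₗ[ℝ] Lp ℝ 2 ν →ₗ[ℝ] Lp E 2 (μ.prod ν) :=
  LinearMap.mk₂ ℝ (fun f g => (memLp_prod f g).toLp (fun z : α × β => g z.2 • f z.1))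
    (by
      intro f f' g
      rw [← MemLp.toLp_add, MemLp.toLp_eq_toLp_iff]
      filter_upwards [ae_comp_fst (ν := ν) (Lp.coeFn_add f f')] with z h
      simp only [Pi.add_apply] at h ⊢
      rw [h, smul_add])
    (by
      intro a f g
      rw [← MemLp.toLp_const_smul, MemLp.toLp_eq_toLp_iff]
      filter_upwards [ae_comp_fst (ν := ν) (Lp.coeFn_smul a f)] with z h
      simp only [Pi.smul_apply] at h ⊢
      rw [h, smul_comm])
    (by
      intro f g g'
      rw [← MemLp.toLp_add, MemLp.toLp_eq_toLp_iff]
      filter_upwards [ae_comp_snd (μ := μ) (Lp.coeFn_add g g')] with z h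
      simp only [Pi.add_apply] at h ⊢
      rw [h, add_smul])
    (by
      intro a f g
      rw [← MemLp.toLp_const_smul, MemLp.toLp_eq_toLp_iff]
      filter_upwards [ae_comp_snd (μ := μ) (Lp.coeFn_smul a g)] with z h
      simp only [Pi.smul_apply] at h ⊢
      rw [h, smul_assoc])

section Tensor

variable {d : ℕ} {Ω : Set (Sp d)} {T : ℝ}

/-- For `W = ∑ φ_i ⊗ m_i ∈ S ⊗ M`, where every `m ∈ M` has the profile `b m ∈ L²(0,T)`: the function
`∑ φ_i(x) (b m_i)(t)` in `L²(Q_T)`. -/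
def valT {M : Type*} [AddCommGroup M] [Module ℝ M] (S : Submodule ℝ (L2S Ω × L2SVec Ω))
    (b : M →ₗ[ℝ] L2T T) : (S ⊗[ℝ] M) →ₗ[ℝ] L2Q Ω T :=
  TensorProduct.lift ((prodLp (muS Ω) (muT T)).compl₁₂
    ((LinearMap.fst ℝ (L2S Ω) (L2SVec Ω)).comp S.subtype) b)

/-- For `W = ∑ φ_i ⊗ m_i ∈ S ⊗ M`, where every `m ∈ M` has the profile `b m ∈ L²(0,T)`: the spatial
gradient `∑ ∇φ_i(x) (b m_i)(t)` in `L²(Q_T)^d`. -/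
def gradT {M : Type*} [AddCommGroup M] [Module ℝ M] (S : Submodule ℝ (L2S Ω × L2SVec Ω))
    (b : M →ₗ[ℝ] L2T T) : (S ⊗[ℝ] M) →ₗ[ℝ] L2QVec Ω T :=
  TensorProduct.lift ((prodLp (muS Ω) (muT T)).compl₁₂
    ((LinearMap.snd ℝ (L2S Ω) (L2SVec Ω)).comp S.subtype) b)

/-- `∂_t R = {u' : u ∈ R} ⊆ L²(0,T)` for a space `R ⊆ H¹_{0,•}(0,T)` of functions of time. -/
def dtSpace (R : Submodule ℝ (L2T T × L2T T)) : Submodule ℝ (L2T T) :=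
  R.map (LinearMap.snd ℝ (L2T T) (L2T T))

/-- The trial space `Q_h(Q_T) = S ⊗ R`. -/
abbrev Trial (S : Submodule ℝ (L2S Ω × L2SVec Ω)) (R : Submodule ℝ (L2T T × L2T T)) : Type :=
  S ⊗[ℝ] R

/-- The test space `∂_t Q_h(Q_T) = S ⊗ ∂_t R`. -/
abbrev TestSp (S : Submodule ℝ (L2S Ω × L2SVec Ω)) (R : Submodule ℝ (L2T T × L2T T)) : Type :=
  S ⊗[ℝ] (dtSpace R)

variable (S : Submodule ℝ (L2S Ω × L2SVec Ω)) (R : Submodule ℝ (L2T T × L2T T))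

/-- `U_h ∈ L²(Q_T)`. -/
def trialVal : Trial S R →ₗ[ℝ] L2Q Ω T :=
  valT S ((LinearMap.fst ℝ (L2T T) (L2T T)).comp R.subtype)

/-- `∂_t U_h ∈ L²(Q_T)`. -/
def trialDt : Trial S R →ₗ[ℝ] L2Q Ω T :=
  valT S ((LinearMap.snd ℝ (L2T T) (L2T T)).comp R.subtype)

/-- `∇_x U_h ∈ L²(Q_T)^d`. -/
def trialGrad : Trial S R →ₗ[ℝ] L2QVec Ω T :=
  gradT S ((LinearMap.fst ℝ (L2T T) (L2T T)).comp R.subtype)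

/-- `λ_h ∈ L²(Q_T)` for a discrete test function. -/
def testVal : TestSp S R →ₗ[ℝ] L2Q Ω T := valT S (dtSpace R).subtype

/-- `∇_x λ_h ∈ L²(Q_T)^d` for a discrete test function. -/
def testGrad : TestSp S R →ₗ[ℝ] L2QVec Ω T := gradT S (dtSpace R).subtype

/-! ## The discrete problem -/

/-- The bilinear form
`A((U,V),(λ,χ)) = (∂_t V, λ)_e + (c² ∇U, ∇λ)_e - (∂_t U, χ)_e + (V, χ)_e`. -/
def formA (c : Sp d → ℝ) (U V : Trial S R) (l χ : TestSp S R) : ℝ :=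
  ipE Ω T (trialDt S R V) (testVal S R l)
    + ipE Ω T (fun z => c z.1 ^ 2 • trialGrad S R U z) (testGrad S R l)
    - ipE Ω T (trialDt S R U) (testVal S R χ)
    + ipE Ω T (trialVal S R V) (testVal S R χ)

/-- `(U, V) ∈ Q_h(Q_T)²` solves the discrete problem
`A((U,V),(λ,χ)) = (F, λ)_e - (c² ∇U₀, ∇λ)_e - (V₀, χ)_e` for all `(λ, χ) ∈ (∂_t Q_h(Q_T))²`;
here `U₀` is the pair `(U₀, ∇U₀)`. -/
def IsDiscreteSolution (c : Sp d → ℝ) (U₀ : L2S Ω × L2SVec Ω) (V₀ : L2S Ω) (F : L2Q Ω T)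
    (W : Trial S R × Trial S R) : Prop :=
  ∀ l χ : TestSp S R,
    formA S R c W.1 W.2 l χ =
      ipE Ω T F (testVal S R l)
        - ipE Ω T (fun z => c z.1 ^ 2 • U₀.2 z.1) (testGrad S R l)
        - ipE Ω T (fun z => V₀ z.1) (testVal S R χ)

/-! ## The discrete norm -/

/-- `N ∈ S ⊗ L²(0,T)` is the discrete Newton potential of `W ∈ L²(Q_T)`:
`(c² ∇N, ∇Z)_e = (W, Z)_e` for all `Z ∈ S ⊗ L²(0,T)`. -/
def IsDiscreteNewton (c : Sp d → ℝ) (W : L2Q Ω T) (N : S ⊗[ℝ] L2T T) : Prop :=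
  ∀ Z : S ⊗[ℝ] L2T T,
    ipE Ω T (fun z => c z.1 ^ 2 • gradT S LinearMap.id N z) (gradT S LinearMap.id Z)
      = ipE Ω T W (valT S LinearMap.id Z)

open Classical in
/-- The discrete Newton potential of `W ∈ L²(Q_T)`; it exists and is unique as soon as `c` is bounded
and bounded away from zero and `S ⊆ H¹₀(Ω)` is finite dimensional. -/
def discreteNewton (c : Sp d → ℝ) (W : L2Q Ω T) : S ⊗[ℝ] L2T T :=
  if h : ∃ N, IsDiscreteNewton S c W N then h.choose else 0

/-- The seminorm `‖c ∇ N_h W‖_{L²_e(Q_T)}` of `W ∈ L²(Q_T)`. -/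
def normN (c : Sp d → ℝ) (W : L2Q Ω T) : ℝ :=
  normE Ω T (fun z => c z.1 • gradT S LinearMap.id (discreteNewton S c W) z)

/-- The discrete norm
`‖(U,V)‖² = ‖∂_t U‖²_e + ‖c ∇ N_h ∂_t V‖²_e + ‖c ∇U‖²_e + ‖V‖²_e` on `Q_h(Q_T)²`. -/
def normVeh (c : Sp d → ℝ) (W : Trial S R × Trial S R) : ℝ :=
  Real.sqrt (normE Ω T (trialDt S R W.1) ^ 2 + normN S c (trialDt S R W.2) ^ 2
    + normE Ω T (fun z => c z.1 • trialGrad S R W.1 z) ^ 2 + normE Ω T (trialVal S R W.2) ^ 2)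

end Tensor

end WaveDisc

end

/-!
Put `E = e^{-1}`. All estimates rest on the weight `e^{-t/T}`: for `w ∈ H¹_{0,•}(0,T)` integration
by parts gives `2 (w, w')_e = E w(T)² + |w|²_e / T` (`two_tip_deriv`).

**Decoupling.** The space `S` has a basis `φ_i` that is orthonormal in `L²(Ω)` and orthogonal for
`(c² ∇·, ∇·)`, with `(c² ∇φ_i, ∇φ_i) = s_i` (`exists_modal_basis`; the `L²` product is definite on
`S` because the weak gradient is determined by the function, `H10.snd_eq_zero`). Writing `U = ∑
φ_i ⊗ u_i` and `V = ∑ φ_i ⊗ v_i`, the discrete problem and the discrete norm become sums over `i`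
of expressions in `(u_i, v_i)`, and `N_h` is division by `s_i`.

**Unique solvability.** The system is square. Testing the homogeneous problem with `(∂_t U, ∂_t
V)` gives `∑ s_i (u_i, u_i')_e + (v_i, v_i')_e = 0`, so `V = 0`; then `∂_t U = 0` and `∂_t V = 0`
follow from the two equations (`formL_injective`, `formL_bijective`).

**Stability.** By linearity the solution is the sum of the response to `F` and `U₀` and of the
response to `V₀`. The first has the right hand side `(F + g, λ)_e`, and with `κ = C_Ω / c_0`, so
that `s_i ≥ κ⁻²`, the tests `(∂_t U, ∂_t V)`, `χ = ∂_t U` and `λ = N_h ∂_t V` suffice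
(`normVeh_le_of_first`).

For the second, `V₀ ∉ S` in general and the `L²` projection onto `S` need not be stable in `H¹`.
The bound is therefore `2 √T ‖V₀‖_{L²}`, which the Poincaré inequality turns into the claim. It is
shown mode by mode (`mode_bound`) with the constant `4` for the squares: with the mean taken
against the probability measure `E δ_T + T⁻¹ e^{-t/T} dt`, energy conservation reads `mean (s u² +
v² + 2 α v) = 0`. For `s T² ≤ 10` the remaining slack comes from the Poincaré inequality in time
(`tip_self_le_deriv`). For `s T² ≥ 10` it comes from integrating by parts in `(1, u')_e`, the mean
of `u` being small compared with that of `√s u`.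
-/

noncomputable section

namespace WaveDisc

/-! ### Weighted `L²` forms -/

section Weighted

variable {α β E : Type*} [MeasurableSpace α] [MeasurableSpace β] {μ : Measure α} {ν : Measure β}
  [NormedAddCommGroup E] [InnerProductSpace ℝ E]

theorem integrable_inner_mul {ρ : α → ℝ} (hρ : MemLp ρ ⊤ μ) (f g : Lp E 2 μ) :
    Integrable (fun x => inner ℝ (f x) (g x) * ρ x) μ := by
  have h1 : MemLp (fun x => inner ℝ (f x) (g x)) 1 μ :=
    memLp_one_iff_integrable.2 (L2.integrable_inner f g)
  exact memLp_one_iff_integrable.1 (hρ.mul' h1)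

/-- The bilinear form `(f, g) ↦ ∫ ⟨f, g⟩ ρ dμ` on `L²(μ)` for a bounded weight `ρ`. -/
def wip {ρ : α → ℝ} (hρ : MemLp ρ ⊤ μ) : Lp E 2 μ →ₗ[ℝ] Lp E 2 μ →ₗ[ℝ] ℝ :=
  LinearMap.mk₂ ℝ (fun f g => ∫ x, inner ℝ (f x) (g x) * ρ x ∂μ)
    (by
      intro f f' g
      rw [← integral_add (integrable_inner_mul hρ f g) (integrable_inner_mul hρ f' g)]
      refine integral_congr_ae ?_
      filter_upwards [Lp.coeFn_add f f'] with x h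
      rw [h, Pi.add_apply, inner_add_left, add_mul])
    (by
      intro a f g
      rw [smul_eq_mul, ← integral_const_mul]
      refine integral_congr_ae ?_
      filter_upwards [Lp.coeFn_smul a f] with x h
      rw [h, Pi.smul_apply, real_inner_smul_left, mul_assoc])
    (by
      intro f g g'
      rw [← integral_add (integrable_inner_mul hρ f g) (integrable_inner_mul hρ f g')]
      refine integral_congr_ae ?_
      filter_upwards [Lp.coeFn_add g g'] with x h
      rw [h, Pi.add_apply, inner_add_right, add_mul])
    (by
      intro a f g
      rw [smul_eq_mul, ← integral_const_mul]
      refine integral_congr_ae ?_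
      filter_upwards [Lp.coeFn_smul a g] with x h
      rw [h, Pi.smul_apply, real_inner_smul_right, mul_assoc])

theorem wip_apply {ρ : α → ℝ} (hρ : MemLp ρ ⊤ μ) (f g : Lp E 2 μ) :
    wip hρ f g = ∫ x, inner ℝ (f x) (g x) * ρ x ∂μ := rfl

theorem wip_comm {ρ : α → ℝ} (hρ : MemLp ρ ⊤ μ) (f g : Lp E 2 μ) : wip hρ f g = wip hρ g f := by
  simp only [wip_apply, real_inner_comm]

theorem wip_self_nonneg {ρ : α → ℝ} (hρ : MemLp ρ ⊤ μ) (h0 : ∀ᵐ x ∂μ, 0 ≤ ρ x) (f : Lp E 2 μ) :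
    0 ≤ wip hρ f f := by
  rw [wip_apply]
  refine integral_nonneg_of_ae ?_
  filter_upwards [h0] with x h
  exact mul_nonneg real_inner_self_nonneg h

theorem eq_zero_of_wip_self_eq_zero {ρ : α → ℝ} (hρ : MemLp ρ ⊤ μ) (h0 : ∀ᵐ x ∂μ, 0 < ρ x)
    (f : Lp E 2 μ) (h : wip hρ f f = 0) : f = 0 := by
  rw [wip_apply, integral_eq_zero_iff_of_nonneg_ae _ (integrable_inner_mul hρ f f)] at h
  · rw [Lp.eq_zero_iff_ae_eq_zero]
    filter_upwards [h, h0] with x h h0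
    simpa [h0.ne'] using h
  · filter_upwards [h0] with x h
    exact mul_nonneg real_inner_self_nonneg h.le

theorem wip_mono {ρ σ : α → ℝ} (hρ : MemLp ρ ⊤ μ) (hσ : MemLp σ ⊤ μ)
    (h : ∀ᵐ x ∂μ, ρ x ≤ σ x) (f : Lp E 2 μ) : wip hρ f f ≤ wip hσ f f := by
  rw [wip_apply, wip_apply]
  refine integral_mono_ae (integrable_inner_mul hρ f f) (integrable_inner_mul hσ f f) ?_
  filter_upwards [h] with x h
  exact mul_le_mul_of_nonneg_left h real_inner_self_nonneg

theorem wip_const (a : ℝ) (ha : MemLp (fun _ : α => a) ⊤ μ) (f g : Lp E 2 μ) :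
    wip ha f g = a * inner ℝ f g := by
  rw [wip_apply, L2.inner_def, ← integral_const_mul]
  simp only [mul_comm]

/-- Cauchy-Schwarz for the weighted product. -/
theorem abs_wip_le {ρ : α → ℝ} (hρ : MemLp ρ ⊤ μ) (h0 : ∀ᵐ x ∂μ, 0 ≤ ρ x) (f g : Lp E 2 μ) :
    |wip hρ f g| ≤ √(wip hρ f f) * √(wip hρ g g) := by
  have h := LinearMap.BilinForm.apply_mul_apply_le_of_forall_zero_le (wip hρ)
    (wip_self_nonneg hρ h0) f g
  rw [wip_comm hρ g f, ← sq] at h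
  rw [← Real.sqrt_mul (wip_self_nonneg hρ h0 f), ← Real.sqrt_sq_eq_abs]
  exact Real.sqrt_le_sqrt h

variable [SFinite μ] [SFinite ν]

theorem prodLp_coe (f : Lp E 2 μ) (g : Lp ℝ 2 ν) :
    (prodLp μ ν f g : α × β → E) =ᵐ[μ.prod ν] fun z => g z.2 • f z.1 :=
  MemLp.coeFn_toLp (memLp_prod f g)

theorem wip_prodLp {ρ : α → ℝ} {σ : β → ℝ} {τ : α × β → ℝ} (hρ : MemLp ρ ⊤ μ) (hσ : MemLp σ ⊤ ν)
    (hτ : MemLp τ ⊤ (μ.prod ν)) (h : ∀ z, τ z = ρ z.1 * σ z.2) (f f' : Lp E 2 μ)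
    (g g' : Lp ℝ 2 ν) :
    wip hτ (prodLp μ ν f g) (prodLp μ ν f' g') = wip hρ f f' * wip hσ g g' := by
  rw [wip_apply, wip_apply, wip_apply, ← integral_prod_mul]
  refine integral_congr_ae ?_
  filter_upwards [prodLp_coe f g, prodLp_coe f' g'] with z h1 h2
  rw [h1, h2, h, real_inner_smul_left, real_inner_smul_right]
  simp only [RCLike.inner_apply, conj_trivial]
  ring

end Weighted

/-! ### Functions of time -/

section Time

variable {T : ℝ}

theorem memLp_exp (hT : 0 < T) : MemLp (fun t : ℝ => Real.exp (-t / T)) ⊤ (muT T) := by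
  refine memLp_top_of_bound (by fun_prop) 1 ?_
  filter_upwards [ae_restrict_mem measurableSet_Ioo] with t ht
  rw [Real.norm_of_nonneg (Real.exp_pos _).le, Real.exp_le_one_iff]
  exact div_nonpos_of_nonpos_of_nonneg (by linarith [ht.1]) hT.le

/-- The scalar product of `L²(0,T)` with weight `e^{-t/T}`. -/
def tip (hT : 0 < T) : L2T T →ₗ[ℝ] L2T T →ₗ[ℝ] ℝ := wip (memLp_exp hT)

/-- The constant function `1` in `L²(0,T)`. -/
def oneT (T : ℝ) : L2T T := (memLp_const (1 : ℝ)).toLp (fun _ : ℝ => (1 : ℝ))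

theorem oneT_coe : (oneT T : ℝ → ℝ) =ᵐ[muT T] fun _ => 1 := MemLp.coeFn_toLp _

theorem tip_comm (hT : 0 < T) (f g : L2T T) : tip hT f g = tip hT g f := wip_comm _ f g

theorem tip_self_nonneg (hT : 0 < T) (f : L2T T) : 0 ≤ tip hT f f :=
  wip_self_nonneg _ (ae_of_all _ fun _ => (Real.exp_pos _).le) f

theorem eq_zero_of_tip_self_eq_zero (hT : 0 < T) {f : L2T T} (h : tip hT f f = 0) : f = 0 :=
  eq_zero_of_wip_self_eq_zero _ (ae_of_all _ fun _ => Real.exp_pos _) f h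

theorem tip_apply (hT : 0 < T) (f g : L2T T) :
    tip hT f g = ∫ t in (0 : ℝ)..T, f t * g t * Real.exp (-t / T) := by
  rw [tip, wip_apply, intervalIntegral.integral_of_le hT.le, integral_Ioc_eq_integral_Ioo]
  simp only [RCLike.inner_apply, conj_trivial, mul_comm]

/-- The weighted product on `(0,T)` tested against an absolutely continuous function: integration by
parts against the weight `e^{-t/T}`, whose derivative is `-(1/T) e^{-t/T}`. -/
theorem integral_deriv_mul_exp (hT : 0 < T) {f : ℝ → ℝ}
    (hf : AbsolutelyContinuousOnInterval f 0 T) :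
    ∫ t in (0 : ℝ)..T, deriv f t * Real.exp (-t / T) =
      Real.exp (-1) * f T - f 0 + (∫ t in (0 : ℝ)..T, f t * Real.exp (-t / T)) / T := by
  have hd : ∀ t : ℝ, HasDerivAt (fun t : ℝ => Real.exp (-t / T))
      (Real.exp (-t / T) * (-1 / T)) t := fun t =>
    (((hasDerivAt_id t).neg).div_const T).exp
  have hcd : ContDiff ℝ 1 (fun t : ℝ => Real.exp (-t / T)) := by fun_prop
  have hg : AbsolutelyContinuousOnInterval (fun t : ℝ => Real.exp (-t / T)) 0 T := by
    obtain ⟨K, hK⟩ :=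
      (hcd.locallyLipschitz.locallyLipschitzOn (s := uIcc 0 T)).exists_lipschitzOnWith_of_compact
        isCompact_uIcc
    exact hK.absolutelyContinuousOnInterval
  have h1 := hf.integral_deriv_mul_eq_sub hg
  rw [intervalIntegral.integral_add] at h1
  · have h2 : ∫ t in (0 : ℝ)..T, f t * deriv (fun t : ℝ => Real.exp (-t / T)) t =
        -((∫ t in (0 : ℝ)..T, f t * Real.exp (-t / T)) / T) := by
      rw [← intervalIntegral.integral_div, ← intervalIntegral.integral_neg]
      refine intervalIntegral.integral_congr fun t _ => ?_
      simp only [(hd t).deriv]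
      ring
    rw [h2] at h1
    have h3 : -T / T = -1 := by field_simp
    simp only [h3, neg_zero, zero_div, Real.exp_zero] at h1
    linarith
  · exact hf.intervalIntegrable_deriv.mul_continuousOn hg.continuousOn
  · refine (hg.intervalIntegrable_deriv).continuousOn_mul hf.continuousOn

/-- The continuous representative `t ↦ ∫_0^t p'` of `p ∈ H¹_{0,•}(0,T)`. -/
def prim (p : L2T T × L2T T) (t : ℝ) : ℝ := ∫ s in (0 : ℝ)..t, p.2 s

theorem intervalIntegrable_coe_full (hT : 0 < T) (g : L2T T) :
    IntervalIntegrable (g : ℝ → ℝ) volume 0 T := by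
  rw [intervalIntegrable_iff_integrableOn_Ioo_of_le hT.le]
  exact (Lp.memLp g).integrable (by norm_num)

theorem prim_ac (hT : 0 < T) (p : L2T T × L2T T) : AbsolutelyContinuousOnInterval (prim p) 0 T :=
  (intervalIntegrable_coe_full hT p.2).absolutelyContinuousOnInterval_intervalIntegral (by simp)

theorem prim_deriv (hT : 0 < T) (p : L2T T × L2T T) :
    ∀ᵐ t ∂(muT T), HasDerivAt (prim p) (p.2 t) t := by
  have h := (intervalIntegrable_coe_full hT p.2).ae_hasDerivAt_integral
  rw [ae_restrict_iff' measurableSet_Ioo]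
  filter_upwards [h] with t h ht
  exact h (by rw [uIcc_of_le hT.le]; exact Ioo_subset_Icc_self ht) 0 (by simp)

theorem intervalIntegral_congr_muT (hT : 0 < T) {f g : ℝ → ℝ} (h : ∀ᵐ t ∂(muT T), f t = g t) :
    ∫ t in (0 : ℝ)..T, f t = ∫ t in (0 : ℝ)..T, g t := by
  rw [intervalIntegral.integral_of_le hT.le, intervalIntegral.integral_of_le hT.le,
    integral_Ioc_eq_integral_Ioo, integral_Ioc_eq_integral_Ioo]
  exact integral_congr_ae h

theorem tip_deriv_one (hT : 0 < T) {p : L2T T × L2T T} (hp : p ∈ H1Zero T) :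
    tip hT (oneT T) p.2 = Real.exp (-1) * prim p T + tip hT (oneT T) p.1 / T := by
  have h := integral_deriv_mul_exp hT (prim_ac hT p)
  have h0 : prim p 0 = 0 := by simp [prim]
  rw [h0, sub_zero] at h
  rw [tip_apply, tip_apply]
  convert h using 1
  · refine intervalIntegral_congr_muT hT ?_
    filter_upwards [prim_deriv hT p, oneT_coe] with t h1 h2
    rw [h1.deriv, h2, one_mul]
  · congr 2
    refine intervalIntegral_congr_muT hT ?_
    filter_upwards [show ∀ᵐ t ∂(muT T), p.1 t = prim p t from hp, oneT_coe] with t h1 h2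
    rw [h1, h2, one_mul]

/-- The energy identity in time. -/
theorem two_tip_deriv (hT : 0 < T) {p : L2T T × L2T T} (hp : p ∈ H1Zero T) :
    2 * tip hT p.1 p.2 = Real.exp (-1) * prim p T ^ 2 + tip hT p.1 p.1 / T := by
  have h := integral_deriv_mul_exp hT ((prim_ac hT p).fun_mul (prim_ac hT p))
  have h0 : prim p 0 = 0 := by simp [prim]
  rw [h0, mul_zero, sub_zero] at h
  rw [tip_apply, tip_apply, sq, ← intervalIntegral.integral_const_mul]
  have hp' : ∀ᵐ t ∂(muT T), p.1 t = prim p t := hp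
  convert h using 1
  · refine intervalIntegral_congr_muT hT ?_
    filter_upwards [prim_deriv hT p, hp'] with t h1 h2
    rw [(h1.fun_mul h1).deriv, h2]
    ring
  · congr 2
    refine intervalIntegral_congr_muT hT ?_
    filter_upwards [hp'] with t h1
    rw [h1]

theorem tip_oneT (hT : 0 < T) : tip hT (oneT T) (oneT T) = T * (1 - Real.exp (-1)) := by
  have hd : ∀ t : ℝ, HasDerivAt (fun t : ℝ => -T * Real.exp (-t / T)) (Real.exp (-t / T)) t := by
    intro t
    have := ((((hasDerivAt_id t).neg).div_const T).exp).const_mul (-T)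
    refine this.congr_deriv ?_
    rw [mul_left_comm, show -T * (-1 / T) = 1 by field_simp]
    exact mul_one _
  rw [tip_apply, intervalIntegral_congr_muT hT (g := fun t => Real.exp (-t / T)),
    intervalIntegral.integral_eq_sub_of_hasDerivAt (fun t _ => hd t)
      (Continuous.intervalIntegrable (by fun_prop) _ _)]
  · have h3 : -T / T = -1 := by field_simp
    simp only [h3, neg_zero, zero_div, Real.exp_zero]
    ring
  · filter_upwards [oneT_coe] with t h
    rw [h, one_mul, one_mul]

/-- A Poincaré inequality in time: `w(t)² e^{-t/T} ≤ t ∫_0^t w'(s)² e^{-s/T} ds` as the weight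
decreases. -/
theorem tip_self_le_deriv (hT : 0 < T) {p : L2T T × L2T T} (hp : p ∈ H1Zero T) :
    tip hT p.1 p.1 ≤ T ^ 2 / 2 * tip hT p.2 p.2 := by
  have hp' : ∀ᵐ t ∂(muT T), p.1 t = prim p t := hp
  have hsq : Integrable (fun s => p.2 s ^ 2) (muT T) :=
    (memLp_two_iff_integrable_sq (Lp.aestronglyMeasurable p.2)).1 (Lp.memLp p.2)
  have hI : IntegrableOn (fun s => p.2 s * p.2 s * Real.exp (-s / T)) (Ioo 0 T) volume := by
    exact integrable_inner_mul (memLp_exp hT) p.2 p.2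
  have key : ∀ t ∈ Ioo 0 T, prim p t * prim p t * Real.exp (-t / T) ≤ t * tip hT p.2 p.2 := by
    intro t ht
    have hsub : Ioc 0 t ⊆ Ioo 0 T := fun s hs => ⟨hs.1, hs.2.trans_lt ht.2⟩
    have i1 : IntervalIntegrable (fun s => p.2 s ^ 2) volume 0 t := by
      rw [intervalIntegrable_iff_integrableOn_Ioc_of_le ht.1.le]
      exact IntegrableOn.mono_set (show IntegrableOn _ (Ioo 0 T) volume from hsq) hsub
    have i2 := intervalIntegrable_coe p.2 ht
    -- Cauchy-Schwarz on `(0,t)`: expand `∫_0^t (t p'(s) - p(t))² ds ≥ 0`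
    have hcs : prim p t * prim p t ≤ t * ∫ s in (0 : ℝ)..t, p.2 s ^ 2 := by
      have h0 : 0 ≤ ∫ s in (0 : ℝ)..t,
          (t ^ 2 * p.2 s ^ 2 - 2 * t * prim p t * p.2 s + prim p t ^ 2) :=
        intervalIntegral.integral_nonneg ht.1.le fun s _ => by
          nlinarith [sq_nonneg (t * p.2 s - prim p t)]
      rw [intervalIntegral.integral_add ((i1.const_mul _).sub (i2.const_mul _)) (by simp),
        intervalIntegral.integral_sub (i1.const_mul _) (i2.const_mul _),
        intervalIntegral.integral_const_mul, intervalIntegral.integral_const_mul,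
        intervalIntegral.integral_const, smul_eq_mul, sub_zero,
        show ∫ s in (0 : ℝ)..t, p.2 s = prim p t from rfl] at h0
      have : 0 ≤ t * (t * (∫ s in (0 : ℝ)..t, p.2 s ^ 2) - prim p t * prim p t) := by linarith
      linarith [nonneg_of_mul_nonneg_right this ht.1]
    have hexp : (∫ s in (0 : ℝ)..t, p.2 s ^ 2) * Real.exp (-t / T) ≤ tip hT p.2 p.2 := by
      rw [tip_apply, ← intervalIntegral.integral_mul_const,
        intervalIntegral.integral_of_le ht.1.le, intervalIntegral.integral_of_le hT.le,
        integral_Ioc_eq_integral_Ioo (x := 0) (y := T)]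
      calc _ ≤ ∫ s in Ioc 0 t, p.2 s * p.2 s * Real.exp (-s / T) := by
            refine setIntegral_mono_on ?_ (hI.mono_set hsub) measurableSet_Ioc ?_
            · exact (i1.1).mul_const _
            · intro s hs
              rw [← sq]
              refine mul_le_mul_of_nonneg_left (Real.exp_le_exp.2 ?_) (sq_nonneg _)
              exact div_le_div_of_nonneg_right (by linarith [hs.2]) hT.le
        _ ≤ _ := by
            refine setIntegral_mono_set hI (ae_of_all _ fun s => ?_) (ae_of_all _ hsub)
            exact mul_nonneg (mul_self_nonneg _) (Real.exp_pos _).le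
    calc _ ≤ (t * ∫ s in (0 : ℝ)..t, p.2 s ^ 2) * Real.exp (-t / T) :=
          mul_le_mul_of_nonneg_right hcs (Real.exp_pos _).le
      _ = t * ((∫ s in (0 : ℝ)..t, p.2 s ^ 2) * Real.exp (-t / T)) := by ring
      _ ≤ _ := mul_le_mul_of_nonneg_left hexp ht.1.le
  have h1 : tip hT p.1 p.1 ≤ ∫ t in (0 : ℝ)..T, t * tip hT p.2 p.2 := by
    rw [tip_apply, intervalIntegral.integral_of_le hT.le, intervalIntegral.integral_of_le hT.le,
      integral_Ioc_eq_integral_Ioo, integral_Ioc_eq_integral_Ioo]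
    refine integral_mono_ae ?_ ?_ ?_
    · exact integrable_inner_mul (memLp_exp hT) p.1 p.1
    · exact (Continuous.integrableOn_Icc (by fun_prop)).mono_set Ioo_subset_Icc_self
    · filter_upwards [hp', ae_restrict_mem measurableSet_Ioo] with t h ht
      rw [h]
      exact key t ht
  refine h1.trans (le_of_eq ?_)
  rw [intervalIntegral.integral_mul_const, integral_id]
  ring

theorem H1Zero.fst_eq_zero (hT : 0 < T) {p : L2T T × L2T T} (hp : p ∈ H1Zero T) (h : p.2 = 0) :
    p.1 = 0 := by
  have h1 := tip_self_le_deriv hT hp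
  rw [h, map_zero, mul_zero] at h1
  exact eq_zero_of_tip_self_eq_zero hT (le_antisymm h1 (tip_self_nonneg hT _))

end Time

/-! ### The space `H¹₀(Ω)` -/

section Sobolev

variable {d : ℕ} {Ω : Set (Sp d)}

/-- A continuous linear functional on `L²(Ω) × L²(Ω)^d` that vanishes on the pairs `(φ, ∇φ)` with
`φ ∈ C_c^∞(Ω)` vanishes on `H¹₀(Ω)`. -/
theorem inner_add_inner_eq_zero_of_test (a : L2S Ω) (b : L2SVec Ω)
    (h : ∀ φ : Sp d → ℝ, IsTest Ω φ →
      ∫ x, a x * φ x ∂(muS Ω) + ∫ x, inner ℝ (b x) (gradient φ x) ∂(muS Ω) = 0)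
    {p : L2S Ω × L2SVec Ω} (hp : p ∈ H10 Ω) : inner ℝ a p.1 + inner ℝ b p.2 = 0 := by
  let L : (L2S Ω × L2SVec Ω) →L[ℝ] ℝ := (innerSL ℝ a).coprod (innerSL ℝ b)
  have hL : ∀ q : L2S Ω × L2SVec Ω, L q = inner ℝ a q.1 + inner ℝ b q.2 := fun q => by
    simp [L, ContinuousLinearMap.coprod_apply]
  have hle : H10 Ω ≤ LinearMap.ker (L : (L2S Ω × L2SVec Ω) →ₗ[ℝ] ℝ) := by
    refine Submodule.topologicalClosure_minimal _ (Submodule.span_le.2 ?_) L.isClosed_ker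
    rintro q ⟨φ, hφ, h1, h2⟩
    change L q = 0
    rw [hL, ← h φ hφ, L2.inner_def, L2.inner_def]
    congr 1
    · refine integral_congr_ae ?_
      filter_upwards [h1] with x hx
      rw [hx]
      simp [mul_comm]
    · refine integral_congr_ae ?_
      filter_upwards [h2] with x hx
      rw [hx]
  rw [← hL]
  exact hle hp

theorem inner_gradient {φ : Sp d → ℝ} (x v : Sp d) :
    inner ℝ v (gradient φ x) = fderiv ℝ φ x v := by
  rw [real_inner_comm, gradient, InnerProductSpace.toDual_symm_apply]

/-- Integration by parts for two test functions. -/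
theorem integral_fderiv_mul_test {φ ψ : Sp d → ℝ} (hφ : IsTest Ω φ) (hψ : IsTest Ω ψ) (v : Sp d) :
    ∫ x, fderiv ℝ ψ x v * φ x ∂(muS Ω) + ∫ x, ψ x * fderiv ℝ φ x v ∂(muS Ω) = 0 := by
  have z : ∀ x, x ∉ Ω → ψ x = 0 := fun x hx =>
    image_eq_zero_of_notMem_tsupport fun h => hx (hψ.2.2 h)
  have z' : ∀ x, x ∉ Ω → φ x = 0 := fun x hx =>
    image_eq_zero_of_notMem_tsupport fun h => hx (hφ.2.2 h)
  rw [setIntegral_eq_integral_of_forall_compl_eq_zero (fun x hx => by simp [z' x hx]),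
    setIntegral_eq_integral_of_forall_compl_eq_zero (fun x hx => by simp [z x hx])]
  have c1 : Continuous fun x => fderiv ℝ ψ x v :=
    (hψ.1.continuous_fderiv (by simp)).clm_apply continuous_const
  have c2 : Continuous fun x => fderiv ℝ φ x v :=
    (hφ.1.continuous_fderiv (by simp)).clm_apply continuous_const
  have := integral_mul_fderiv_eq_neg_fderiv_mul_of_integrable (μ := (volume : Measure (Sp d)))
    (f := ψ) (g := φ) (v := v)
    ((c1.mul hφ.1.continuous).integrable_of_hasCompactSupport hφ.2.1.mul_left)
    ((hψ.1.continuous.mul c2).integrable_of_hasCompactSupport hψ.2.1.mul_right)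
    ((hψ.1.continuous.mul hφ.1.continuous).integrable_of_hasCompactSupport hψ.2.1.mul_right)
    (fun x _ => hφ.1.differentiable (by simp) x |> fun _ => hψ.1.differentiable (by simp) x)
    (fun x _ => hφ.1.differentiable (by simp) x)
  rw [this]
  ring

/-- The weak gradient is determined by the function: `(u, ∇u) ∈ H¹₀(Ω)` with `u = 0` has
`∇u = 0`. -/
theorem H10.snd_eq_zero (hΩ : IsOpen Ω) {p : L2S Ω × L2SVec Ω} (hp : p ∈ H10 Ω) (h : p.1 = 0) :
    p.2 = 0 := by
  have hae : ∀ᵐ x ∂(volume : Measure (Sp d)), x ∈ Ω → p.2 x = 0 := by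
    refine hΩ.ae_eq_zero_of_integral_contDiff_smul_eq_zero ?_ ?_
    · have h2 : LocallyIntegrable p.2 (muS Ω) := (Lp.memLp p.2).locallyIntegrable (by norm_num)
      exact locallyIntegrableOn_of_locallyIntegrable_restrict h2
    · intro ψ hψ1 hψ2 hψ3
      have hψ : IsTest Ω ψ := ⟨hψ1, hψ2, hψ3⟩
      rw [← setIntegral_eq_integral_of_forall_compl_eq_zero (s := Ω) (fun x hx => by
        rw [image_eq_zero_of_notMem_tsupport fun h => hx (hψ3 h), zero_smul])]
      have hψL : MemLp ψ 2 (muS Ω) :=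
        (hψ1.continuous.memLp_of_hasCompactSupport hψ2).restrict Ω
      have hψinf : MemLp ψ ⊤ (muS Ω) :=
        (hψ1.continuous.memLp_of_hasCompactSupport hψ2).restrict Ω
      have hint : Integrable (fun x => ψ x • p.2 x) (muS Ω) :=
        memLp_one_iff_integrable.1 ((Lp.memLp p.2).smul hψL)
      refine ext_inner_left ℝ fun v => ?_
      rw [inner_zero_right, ← integral_inner hint]
      have ha : MemLp (fun x => fderiv ℝ ψ x v) 2 (muS Ω) :=
        (((hψ1.continuous_fderiv (by simp)).clm_apply continuous_const).memLp_of_hasCompactSupport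
          (hψ2.fderiv_apply ℝ v)).restrict Ω
      have hb : MemLp (fun x => ψ x • v) 2 (muS Ω) :=
        ((hψ1.continuous.smul continuous_const).memLp_of_hasCompactSupport
          hψ2.smul_right).restrict Ω
      have key := inner_add_inner_eq_zero_of_test (ha.toLp _) (hb.toLp _) (fun φ hφ => by
        rw [← integral_fderiv_mul_test hφ hψ v]
        congr 1
        · refine integral_congr_ae ?_
          filter_upwards [ha.coeFn_toLp] with x hx
          rw [hx]
        · refine integral_congr_ae ?_
          filter_upwards [hb.coeFn_toLp] with x hx
          rw [hx, real_inner_smul_left, inner_gradient]) hp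
      rw [h, inner_zero_right, zero_add, L2.inner_def] at key
      rw [← key]
      refine integral_congr_ae ?_
      filter_upwards [hb.coeFn_toLp] with x hx
      rw [hx, real_inner_smul_left, real_inner_smul_right]
  rw [Lp.eq_zero_iff_ae_eq_zero]
  exact (ae_restrict_iff' hΩ.measurableSet).2 hae

theorem memLp_sq_top {c : Sp d → ℝ} (hc : MemLp c ⊤ (muS Ω)) :
    MemLp (fun x => c x ^ 2) ⊤ (muS Ω) := by
  simpa only [sq] using hc.mul' hc

/-- The defining property of the weak divergence extends from test functions to `H¹₀(Ω)`. -/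
theorem IsWeakDiv.inner_eq {c : Sp d → ℝ} (hc : MemLp c ⊤ (muS Ω)) {f : L2SVec Ω} {g : L2S Ω}
    (h : IsWeakDiv Ω (fun x => c x ^ 2 • f x) g) {p : L2S Ω × L2SVec Ω} (hp : p ∈ H10 Ω) :
    wip (memLp_sq_top hc) f p.2 = -inner ℝ g p.1 := by
  have hf : MemLp (fun x => c x ^ 2 • f x) 2 (muS Ω) := (Lp.memLp f).smul (memLp_sq_top hc)
  have key := inner_add_inner_eq_zero_of_test g (hf.toLp _) (fun φ hφ => by
    rw [h φ hφ, neg_add_eq_zero]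
    refine integral_congr_ae ?_
    filter_upwards [hf.coeFn_toLp] with x hx
    rw [hx]) hp
  rw [eq_neg_iff_add_eq_zero, add_comm, ← key]
  congr 1
  rw [wip_apply, L2.inner_def]
  refine integral_congr_ae ?_
  filter_upwards [hf.coeFn_toLp] with x hx
  rw [hx, real_inner_smul_left, mul_comm]

end Sobolev

/-! ### Spectral basis in space and modal coordinates -/

section Spectral

/-- Simultaneous diagonalization of the scalar product pulled back along an injective map `J` and of
a symmetric bilinear form `b` on a finite dimensional space. -/
theorem exists_basis_diagonal {V H : Type*} [AddCommGroup V] [Module ℝ V] [FiniteDimensional ℝ V]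
    [NormedAddCommGroup H] [InnerProductSpace ℝ H] (J : V →ₗ[ℝ] H) (hJ : Function.Injective J)
    (b : V →ₗ[ℝ] V →ₗ[ℝ] ℝ) (hb : ∀ x y, b x y = b y x) :
    ∃ (n : ℕ) (φ : Module.Basis (Fin n) ℝ V) (s : Fin n → ℝ),
      (∀ i j, inner ℝ (J (φ i)) (J (φ j)) = if i = j then 1 else 0) ∧
      ∀ i j, b (φ i) (φ j) = if i = j then s i else 0 := by
  let e : V ≃ₗ[ℝ] LinearMap.range J := LinearEquiv.ofInjective J hJ
  let o := stdOrthonormalBasis ℝ (LinearMap.range J)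
  let A : LinearMap.range J →ₗ[ℝ] LinearMap.range J :=
    ∑ k, ((b.flip (e.symm (o k))).comp e.symm.toLinearMap).smulRight (o k)
  have hA : ∀ x y, inner ℝ (A x) y = b (e.symm x) (e.symm y) := by
    intro x y
    conv_rhs => rw [← o.sum_repr' y]
    simp [A, sum_inner, real_inner_smul_left, mul_comm]
  have hsym : A.IsSymmetric := fun x y => by
    rw [hA, real_inner_comm, hA, hb]
  let w := hsym.eigenvectorBasis rfl
  refine ⟨_, w.toBasis.map e.symm, hsym.eigenvalues rfl, fun i j => ?_, fun i j => ?_⟩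
  · have h1 : ∀ i, J ((w.toBasis.map e.symm) i) = w i := fun i => by
      rw [Module.Basis.map_apply, w.coe_toBasis]
      exact congrArg Subtype.val (e.apply_symm_apply (w i))
    rw [h1, h1, ← Submodule.coe_inner]
    exact orthonormal_iff_ite.1 w.orthonormal i j
  · rw [Module.Basis.map_apply, Module.Basis.map_apply, w.coe_toBasis, ← hA,
      hsym.apply_eigenvectorBasis, RCLike.ofReal_real_eq_id, id, real_inner_smul_left]
    have := orthonormal_iff_ite.1 w.orthonormal i j
    rw [this]
    simp

theorem exists_sum_tmul {ι V M : Type*} [Fintype ι] [AddCommGroup V] [Module ℝ V]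
    [AddCommGroup M] [Module ℝ M] (φ : Module.Basis ι ℝ V) (w : V ⊗[ℝ] M) :
    ∃ m : ι → M, w = ∑ i, φ i ⊗ₜ[ℝ] m i := by
  classical
  refine ⟨TensorProduct.equivFinsuppOfBasisLeft φ w, ?_⟩
  conv_lhs => rw [← (TensorProduct.equivFinsuppOfBasisLeft φ).symm_apply_apply w]
  rw [TensorProduct.equivFinsuppOfBasisLeft_symm_apply]
  exact Finsupp.sum_fintype _ _ (by simp)

end Spectral

section Modal

variable {d : ℕ} {Ω : Set (Sp d)} {T : ℝ}

theorem memLp_expQ (hT : 0 < T) : MemLp (fun z : Sp d × ℝ => Real.exp (-z.2 / T)) ⊤ (muQ Ω T) := by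
  refine memLp_top_of_bound (by fun_prop) 1 ?_
  filter_upwards [ae_comp_snd (μ := muS Ω) (ae_restrict_mem (μ := volume)
    (measurableSet_Ioo (a := (0 : ℝ)) (b := T)))] with z hz
  rw [Real.norm_of_nonneg (Real.exp_pos _).le, Real.exp_le_one_iff]
  exact div_nonpos_of_nonpos_of_nonneg (by linarith [hz.1]) hT.le

/-- The scalar product of `L²_e(Q_T)`. -/
def qip (hT : 0 < T) : L2Q Ω T →ₗ[ℝ] L2Q Ω T →ₗ[ℝ] ℝ := wip (memLp_expQ hT)

theorem memLp_sq_mul_expQ (hT : 0 < T) {c : Sp d → ℝ} (hc : MemLp c ⊤ (muS Ω)) :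
    MemLp (fun z : Sp d × ℝ => c z.1 ^ 2 * Real.exp (-z.2 / T)) ⊤ (muQ Ω T) := by
  have h : MemLp (fun z : Sp d × ℝ => c z.1 ^ 2) ⊤ (muQ Ω T) :=
    (memLp_sq_top hc).comp_fst _
  exact (memLp_expQ hT).mul' h

/-- The form `(c² G, G')_{L²_e(Q_T)}` for vector fields on the cylinder. -/
def cip (hT : 0 < T) {c : Sp d → ℝ} (hc : MemLp c ⊤ (muS Ω)) :
    L2QVec Ω T →ₗ[ℝ] L2QVec Ω T →ₗ[ℝ] ℝ := wip (memLp_sq_mul_expQ hT hc)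

theorem ipE_eq_qip (hT : 0 < T) (f g : L2Q Ω T) : ipE Ω T f g = qip hT f g := rfl

theorem ipE_eq_cip (hT : 0 < T) {c : Sp d → ℝ} (hc : MemLp c ⊤ (muS Ω)) (f g : L2QVec Ω T) :
    ipE Ω T (fun z => c z.1 ^ 2 • f z) g = cip hT hc f g := by
  rw [cip, wip_apply, ipE]
  refine integral_congr_ae (ae_of_all _ fun z => ?_)
  simp only [real_inner_smul_left]
  ring

theorem qip_self_nonneg (hT : 0 < T) (f : L2Q Ω T) : 0 ≤ qip hT f f :=
  wip_self_nonneg _ (ae_of_all _ fun _ => (Real.exp_pos _).le) f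

theorem cip_self_nonneg (hT : 0 < T) {c : Sp d → ℝ} (hc : MemLp c ⊤ (muS Ω)) (f : L2QVec Ω T) :
    0 ≤ cip hT hc f f :=
  wip_self_nonneg _ (ae_of_all _ fun _ => by positivity) f

theorem normE_sq_eq_qip (hT : 0 < T) (f : L2Q Ω T) : normE Ω T f ^ 2 = qip hT f f := by
  rw [normE, ipE_eq_qip hT, Real.sq_sqrt (qip_self_nonneg hT f)]

theorem normE_sq_eq_cip (hT : 0 < T) {c : Sp d → ℝ} (hc : MemLp c ⊤ (muS Ω)) (f : L2QVec Ω T) :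
    normE Ω T (fun z => c z.1 • f z) ^ 2 = cip hT hc f f := by
  have h : ipE Ω T (fun z => c z.1 • f z) (fun z => c z.1 • f z) = cip hT hc f f := by
    rw [cip, wip_apply, ipE]
    refine integral_congr_ae (ae_of_all _ fun z => ?_)
    simp only [real_inner_smul_left, real_inner_smul_right]
    ring
  rw [normE, h, Real.sq_sqrt (cip_self_nonneg hT hc f)]

theorem ipE_const_eq_qip (hT : 0 < T) (f : L2S Ω) (g : L2Q Ω T) :
    ipE Ω T (fun z => f z.1) g = qip hT (prodLp (muS Ω) (muT T) f (oneT T)) g := by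
  rw [qip, wip_apply, ipE]
  refine integral_congr_ae ?_
  filter_upwards [prodLp_coe (μ := muS Ω) (ν := muT T) f (oneT T),
    ae_comp_snd (μ := muS Ω) (oneT_coe (T := T))] with z h1 h2
  rw [h1, h2, one_smul]

theorem ipE_const_eq_cip (hT : 0 < T) {c : Sp d → ℝ} (hc : MemLp c ⊤ (muS Ω)) (f : L2SVec Ω)
    (g : L2QVec Ω T) :
    ipE Ω T (fun z => c z.1 ^ 2 • f z.1) g =
      cip hT hc (prodLp (muS Ω) (muT T) f (oneT T)) g := by
  rw [cip, wip_apply, ipE]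
  refine integral_congr_ae ?_
  filter_upwards [prodLp_coe (μ := muS Ω) (ν := muT T) f (oneT T),
    ae_comp_snd (μ := muS Ω) (oneT_coe (T := T))] with z h1 h2
  rw [h1, h2, one_smul, real_inner_smul_left]
  ring

theorem qip_prodLp (hT : 0 < T) (f f' : L2S Ω) (g g' : L2T T) :
    qip hT (prodLp (muS Ω) (muT T) f g) (prodLp (muS Ω) (muT T) f' g') =
      inner ℝ f f' * tip hT g g' := by
  rw [qip, wip_prodLp (ρ := fun _ => 1) (memLp_top_const 1) (memLp_exp hT) _
    (fun _ => (one_mul _).symm), wip_const, one_mul, tip]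

theorem cip_prodLp (hT : 0 < T) {c : Sp d → ℝ} (hc : MemLp c ⊤ (muS Ω)) (f f' : L2SVec Ω)
    (g g' : L2T T) :
    cip hT hc (prodLp (muS Ω) (muT T) f g) (prodLp (muS Ω) (muT T) f' g') =
      wip (memLp_sq_top hc) f f' * tip hT g g' :=
  wip_prodLp (memLp_sq_top hc) (memLp_exp hT) _ (fun _ => rfl) f f' g g'

variable {S : Submodule ℝ (L2S Ω × L2SVec Ω)} {ι : Type*} [Fintype ι]
  {M M' : Type*} [AddCommGroup M] [Module ℝ M] [AddCommGroup M'] [Module ℝ M']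

theorem valT_sum (b : M →ₗ[ℝ] L2T T) (φ : ι → S) (m : ι → M) :
    valT S b (∑ i, φ i ⊗ₜ[ℝ] m i) = ∑ i, prodLp (muS Ω) (muT T) (φ i).1.1 (b (m i)) := by
  simp [valT]

theorem gradT_sum (b : M →ₗ[ℝ] L2T T) (φ : ι → S) (m : ι → M) :
    gradT S b (∑ i, φ i ⊗ₜ[ℝ] m i) = ∑ i, prodLp (muS Ω) (muT T) (φ i).1.2 (b (m i)) := by
  simp [gradT]

/-- In an `L²(Ω)`-orthonormal family, the `L²_e(Q_T)` product is the sum over the modes. -/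
theorem qip_valT [DecidableEq ι] (hT : 0 < T) {φ : ι → S}
    (h1 : ∀ i j, inner ℝ (φ i).1.1 (φ j).1.1 = if i = j then (1 : ℝ) else 0)
    (b : M →ₗ[ℝ] L2T T) (b' : M' →ₗ[ℝ] L2T T) (m : ι → M) (m' : ι → M') :
    qip hT (valT S b (∑ i, φ i ⊗ₜ[ℝ] m i)) (valT S b' (∑ i, φ i ⊗ₜ[ℝ] m' i)) =
      ∑ i, tip hT (b (m i)) (b' (m' i)) := by
  rw [valT_sum, valT_sum]
  simp only [map_sum, LinearMap.sum_apply, qip_prodLp, h1]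
  simp

theorem cip_gradT [DecidableEq ι] (hT : 0 < T) {c : Sp d → ℝ} (hc : MemLp c ⊤ (muS Ω))
    {φ : ι → S} {s : ι → ℝ}
    (h2 : ∀ i j, wip (memLp_sq_top hc) (φ i).1.2 (φ j).1.2 = if i = j then s i else 0)
    (b : M →ₗ[ℝ] L2T T) (b' : M' →ₗ[ℝ] L2T T) (m : ι → M) (m' : ι → M') :
    cip hT hc (gradT S b (∑ i, φ i ⊗ₜ[ℝ] m i)) (gradT S b' (∑ i, φ i ⊗ₜ[ℝ] m' i)) =
      ∑ i, s i * tip hT (b (m i)) (b' (m' i)) := by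
  rw [gradT_sum, gradT_sum]
  simp only [map_sum, LinearMap.sum_apply, cip_prodLp, h2]
  simp

theorem exists_modal_basis (hΩ : IsOpen Ω) (hS : S ≤ H10 Ω) [FiniteDimensional ℝ S]
    {c : Sp d → ℝ} (hc : MemLp c ⊤ (muS Ω)) :
    ∃ (n : ℕ) (φ : Module.Basis (Fin n) ℝ S) (s : Fin n → ℝ),
      (∀ i j, inner ℝ (φ i).1.1 (φ j).1.1 = if i = j then (1 : ℝ) else 0) ∧
      ∀ i j, wip (memLp_sq_top hc) (φ i).1.2 (φ j).1.2 = if i = j then s i else 0 := by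
  refine exists_basis_diagonal ((LinearMap.fst ℝ (L2S Ω) (L2SVec Ω)).comp S.subtype) ?_
    ((wip (memLp_sq_top hc)).compl₁₂ ((LinearMap.snd ℝ (L2S Ω) (L2SVec Ω)).comp S.subtype)
      ((LinearMap.snd ℝ (L2S Ω) (L2SVec Ω)).comp S.subtype))
    fun x y => wip_comm (memLp_sq_top hc) _ _
  rw [← LinearMap.ker_eq_bot, LinearMap.ker_eq_bot']
  intro p hp
  have hp1 : p.1.1 = 0 := hp
  exact Subtype.ext (Prod.ext hp1 (H10.snd_eq_zero hΩ (hS p.2) hp1))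

end Modal

/-! ### Bounds for a single mode and for the energies -/

section ModeBounds

variable {T : ℝ}

theorem tip_add_smul_self (hT : 0 < T) (f g : L2T T) (x : ℝ) :
    tip hT (f + x • g) (f + x • g) = tip hT f f + 2 * x * tip hT f g + x ^ 2 * tip hT g g := by
  simp only [map_add, map_smul, LinearMap.add_apply, LinearMap.smul_apply, smul_eq_mul,
    tip_comm hT g f]
  ring

theorem tip_add_smul_nonneg (hT : 0 < T) (f g : L2T T) (x : ℝ) :
    0 ≤ tip hT f f + 2 * x * tip hT f g + x ^ 2 * tip hT g g := by
  rw [← tip_add_smul_self]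
  exact tip_self_nonneg hT _

/-- The response of one spatial mode with frequency `√s` to the initial velocity `α`: the discrete
energy is at most `4 T α²`, whatever the space of trial functions in time. Only the equations tested
with `u'` and `v'` are used. -/
theorem mode_bound (hT : 0 < T) {u v : L2T T × L2T T} (hu : u ∈ H1Zero T) (hv : v ∈ H1Zero T)
    {s α : ℝ} (hs : 0 < s)
    (e1 : tip hT v.2 u.2 + s * tip hT u.1 u.2 = 0)
    (e2 : tip hT v.2 v.2 + s * tip hT u.1 v.2 = 0)
    (e3 : tip hT u.2 u.2 = tip hT v.1 u.2 + α * tip hT (oneT T) u.2)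
    (e4 : tip hT u.2 v.2 = tip hT v.1 v.2 + α * tip hT (oneT T) v.2) :
    tip hT u.2 u.2 + s⁻¹ * tip hT v.2 v.2 + s * tip hT u.1 u.1 + tip hT v.1 v.1 ≤
      4 * T * α ^ 2 := by
  set E := Real.exp (-1) with hE
  have hE1 : 0.36 ≤ E := by have := Real.exp_neg_one_gt_d9; linarith
  have hE2 : E ≤ 1 := Real.exp_le_one_iff.2 (by norm_num)
  have hu1 := two_tip_deriv hT hu
  have hv1 := two_tip_deriv hT hv
  have hu2 := tip_deriv_one hT hu
  have hv2 := tip_deriv_one hT hv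
  have hv3 := tip_self_le_deriv hT hv
  have hk := tip_oneT hT
  rw [← hE] at hu1 hv1 hu2 hv2 hk
  have qu := tip_add_smul_nonneg hT u.1 (oneT T)
  have qv := tip_add_smul_nonneg hT v.1 (oneT T)
  -- `|u'|² = ⟨v + α, u'⟩ = ⟨v + α + x, u'⟩ - x ⟨1, u'⟩` for every constant `x`
  have qa : ∀ x : ℝ, tip hT u.2 u.2 ≤ tip hT v.1 v.1 + 2 * (α + x) * tip hT v.1 (oneT T)
      + (α + x) ^ 2 * tip hT (oneT T) (oneT T) - 2 * x * tip hT (oneT T) u.2 := by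
    intro x
    have h := tip_add_smul_nonneg hT (v.1 + (α + x) • oneT T) u.2 (-1)
    rw [tip_add_smul_self] at h
    simp only [map_add, map_smul, LinearMap.add_apply, LinearMap.smul_apply, smul_eq_mul] at h
    linarith
  have qb : tip hT v.2 v.2 ≤ s ^ 2 * tip hT u.1 u.1 := by
    have h := tip_add_smul_nonneg hT v.2 u.1 s
    rw [tip_comm hT v.2 u.1] at h
    linarith
  rw [tip_comm hT v.2 u.2] at e1
  rw [hk] at qu qv qa
  rw [tip_comm hT (oneT T) u.1] at hu2
  rw [tip_comm hT (oneT T) v.1] at hv2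
  rw [hu2] at qa
  rw [hv2] at e4
  set uu := tip hT u.1 u.1
  set vv := tip hT v.1 v.1
  set a := tip hT u.2 u.2
  set b := tip hT v.2 v.2
  set i := tip hT u.1 (oneT T)
  set j := tip hT v.1 (oneT T)
  set p := prim u T
  set q := prim v T
  have energy : s * (E * T * p ^ 2 + uu) + (E * T * q ^ 2 + vv) + 2 * α * (E * T * q + j) = 0 := by
    have h : s * (E * p ^ 2 + uu / T) + (E * q ^ 2 + vv / T) + 2 * α * (E * q + j / T) = 0 := by
      rw [← hu1, ← hv1]; linarith
    have h' := congrArg (fun y => T * y) h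
    field_simp at h'
    linarith
  have hn : s⁻¹ * b ≤ s * uu := by
    rw [inv_mul_le_iff₀ hs]; linarith
  have hET : 0 < E * T := by positivity
  -- the threshold `10` is not sharp: both cases below leave a margin there
  rcases le_total 10 (s * T ^ 2) with h10 | h10
  · -- high frequency: `x = α` above, and the energy identity is added `5 / 2` times
    have hr : 1 / (s * T ^ 2) ≤ 1 / 10 := one_div_le_one_div_of_le (by norm_num) h10
    have a1 := qa α
    have a2 := qv α
    have a3 : 0 ≤ s * uu + 4 * α * (i / T) + 4 * (1 / (s * T ^ 2)) * (α ^ 2 * (T * (1 - E))) := by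
      have h := mul_nonneg hs.le (qu (2 * α / (s * T)))
      have h2 : s * (uu + 2 * (2 * α / (s * T)) * i + (2 * α / (s * T)) ^ 2 * (T * (1 - E))) =
          s * uu + 4 * α * (i / T) + 4 * (1 / (s * T ^ 2)) * (α ^ 2 * (T * (1 - E))) := by
        field_simp
        ring
      rwa [h2] at h
    have a4 : 0 ≤ 5 / 2 * s * (E * T * p ^ 2) + 2 * α * (E * p)
        + 2 / 5 * (1 / (s * T ^ 2)) * (α ^ 2 * (E * T)) := by
      have h : 0 ≤ 5 / 2 * s * (E * T) * (p + 2 * α / (5 * s * T)) ^ 2 := by positivity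
      have h2 : 5 / 2 * s * (E * T) * (p + 2 * α / (5 * s * T)) ^ 2 =
          5 / 2 * s * (E * T * p ^ 2) + 2 * α * (E * p)
            + 2 / 5 * (1 / (s * T ^ 2)) * (α ^ 2 * (E * T)) := by
        field_simp
        ring
      rwa [h2] at h
    have a5 : 0 ≤ E * T * (q + α) ^ 2 := by positivity
    have a6 : 0 ≤ α ^ 2 * (T * (1 - E)) := by
      have : 0 ≤ 1 - E := by linarith
      positivity
    have a7 := mul_le_mul_of_nonneg_right hr a6
    have a8 := mul_le_mul_of_nonneg_right hr (show 0 ≤ α ^ 2 * (E * T) by positivity)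
    have a9 : 0 ≤ (E - 0.36) * (T * α ^ 2) := mul_nonneg (by linarith) (by positivity)
    have a10 : 0 ≤ T * α ^ 2 := by positivity
    linarith
  · -- low frequency: `x = 0` above, `v` is controlled by `v'`, and the energy identity is added
    -- three times
    have hn2 : vv ≤ 5 * (s⁻¹ * b) := by
      have h1 : s * vv ≤ 5 * b := by
        have hb : 0 ≤ b := tip_self_nonneg hT _
        have := mul_le_mul_of_nonneg_left hv3 hs.le
        have := mul_le_mul_of_nonneg_right h10 hb
        linarith
      have h2 := mul_le_mul_of_nonneg_left h1 (inv_nonneg.2 hs.le)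
      rw [inv_mul_cancel_left₀ hs.ne'] at h2
      linarith
    have a1 := qa 0
    have a2 := qv (5 / 3 * α)
    have a5 : 0 ≤ E * T * (q + α) ^ 2 := by positivity
    have a9 : 0 ≤ (E - 0.36) * (T * α ^ 2) := mul_nonneg (by linarith) (by positivity)
    have a10 : 0 ≤ T * α ^ 2 := by positivity
    have a11 : 0 ≤ s * (E * T * p ^ 2) := by positivity
    linarith

/-- The elementary inequality behind the bound for the right hand side `F`: here
`A = ‖∂_t U‖²`, `N = ‖c ∇ N_h ∂_t V‖²`, `P = ‖c ∇U‖²`, `Q = ‖V‖²`. -/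
theorem energy_bound {A N P Q X κ : ℝ} (hT : 0 < T) (hX : 0 ≤ X) (hκ : 0 ≤ κ) (hA : 0 ≤ A)
    (hN : 0 ≤ N) (hP : 0 ≤ P) (hQ : 0 ≤ Q) (h1 : P + Q ≤ 2 * T * (X * √A)) (h2 : A ≤ √Q * √A)
    (h3 : N ≤ √P * √N + X * (κ * √N)) : A + N + P + Q ≤ 4 * (κ ^ 2 + 4 * T ^ 2) * X ^ 2 := by
  obtain ⟨a, ha, rfl⟩ : ∃ a, 0 ≤ a ∧ A = a ^ 2 := ⟨√A, Real.sqrt_nonneg _, (Real.sq_sqrt hA).symm⟩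
  obtain ⟨n, hn, rfl⟩ : ∃ a, 0 ≤ a ∧ N = a ^ 2 := ⟨√N, Real.sqrt_nonneg _, (Real.sq_sqrt hN).symm⟩
  obtain ⟨p, hp, rfl⟩ : ∃ a, 0 ≤ a ∧ P = a ^ 2 := ⟨√P, Real.sqrt_nonneg _, (Real.sq_sqrt hP).symm⟩
  obtain ⟨q, hq, rfl⟩ : ∃ a, 0 ≤ a ∧ Q = a ^ 2 := ⟨√Q, Real.sqrt_nonneg _, (Real.sq_sqrt hQ).symm⟩
  simp only [Real.sqrt_sq ha, Real.sqrt_sq hn, Real.sqrt_sq hp, Real.sqrt_sq hq] at h1 h2 h3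
  have haq : a ≤ q := by
    by_contra! h
    nlinarith
  have hnp : n ≤ p + X * κ := by
    by_contra! h
    nlinarith [mul_nonneg hX hκ]
  have hTX : 0 ≤ T * X := by positivity
  have hpq : p ^ 2 + q ^ 2 ≤ 2 * (T * X) * q := by
    nlinarith [mul_le_mul_of_nonneg_left haq hTX]
  have hq2 : q ≤ 2 * (T * X) := by
    by_contra! h
    nlinarith [sq_nonneg p]
  have hp1 : p ≤ T * X := abs_le_of_sq_le_sq' (by nlinarith [sq_nonneg (q - T * X)]) hTX |>.2
  have h5 : q * (T * X) ≤ 2 * (T * X) * (T * X) := mul_le_mul_of_nonneg_right hq2 hTX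
  have h6 : a ^ 2 ≤ q ^ 2 := pow_le_pow_left₀ ha haq 2
  have h7 : n ^ 2 ≤ (p + X * κ) ^ 2 := pow_le_pow_left₀ hn hnp 2
  have h8 : p * (X * κ) ≤ T * X * (X * κ) := mul_le_mul_of_nonneg_right hp1 (mul_nonneg hX hκ)
  nlinarith [sq_nonneg (T * X - X * κ), sq_nonneg (T * X), sq_nonneg (X * κ)]

end ModeBounds

/-! ### The discrete problem in modal coordinates -/

section Discrete

variable {d : ℕ} {Ω : Set (Sp d)} {T : ℝ} {c : Sp d → ℝ}
  (S : Submodule ℝ (L2S Ω × L2SVec Ω)) (R : Submodule ℝ (L2T T × L2T T))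

/-- The form `A` as a bilinear map. -/
def formL (hT : 0 < T) (hc : MemLp c ⊤ (muS Ω)) :
    (Trial S R × Trial S R) →ₗ[ℝ] (TestSp S R × TestSp S R) →ₗ[ℝ] ℝ :=
  LinearMap.mk₂ ℝ (fun W l => qip hT (trialDt S R W.2) (testVal S R l.1)
      + cip hT hc (trialGrad S R W.1) (testGrad S R l.1)
      - qip hT (trialDt S R W.1) (testVal S R l.2) + qip hT (trialVal S R W.2) (testVal S R l.2))
    (fun x y l => by simp only [Prod.fst_add, Prod.snd_add, map_add, LinearMap.add_apply]; ring)
    (fun a x l => by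
      simp only [Prod.smul_fst, Prod.smul_snd, map_smul, LinearMap.smul_apply, smul_eq_mul]; ring)
    (fun x l m => by simp only [Prod.fst_add, Prod.snd_add, map_add]; ring)
    (fun a x l => by simp only [Prod.smul_fst, Prod.smul_snd, map_smul, smul_eq_mul]; ring)

theorem formA_eq_formL (hT : 0 < T) (hc : MemLp c ⊤ (muS Ω)) (W : Trial S R × Trial S R)
    (l χ : TestSp S R) : formA S R c W.1 W.2 l χ = formL S R hT hc W (l, χ) := by
  rw [formA, ipE_eq_cip hT hc]
  rfl

/-- The functional `λ ↦ (F, λ)_e - (c² ∇U₀, ∇λ)_e`. -/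
def loadF (hT : 0 < T) (hc : MemLp c ⊤ (muS Ω)) (F : L2Q Ω T) (G : L2SVec Ω) :
    TestSp S R →ₗ[ℝ] ℝ :=
  (qip hT F).comp (testVal S R) -
    (cip hT hc (prodLp (muS Ω) (muT T) G (oneT T))).comp (testGrad S R)

/-- The functional `χ ↦ -(V₀, χ)_e`. -/
def loadV (hT : 0 < T) (V₀ : L2S Ω) : TestSp S R →ₗ[ℝ] ℝ :=
  -(qip hT (prodLp (muS Ω) (muT T) V₀ (oneT T))).comp (testVal S R)

theorem isDiscreteSolution_iff (hT : 0 < T) (hc : MemLp c ⊤ (muS Ω)) (U₀ : L2S Ω × L2SVec Ω)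
    (V₀ : L2S Ω) (F : L2Q Ω T) (W : Trial S R × Trial S R) :
    IsDiscreteSolution S R c U₀ V₀ F W ↔
      formL S R hT hc W = (loadF S R hT hc F U₀.2).coprod (loadV S R hT V₀) := by
  have h : ∀ l χ : TestSp S R, ipE Ω T F (testVal S R l)
        - ipE Ω T (fun z => c z.1 ^ 2 • U₀.2 z.1) (testGrad S R l)
        - ipE Ω T (fun z => V₀ z.1) (testVal S R χ) =
      (loadF S R hT hc F U₀.2).coprod (loadV S R hT V₀) (l, χ) := fun l χ => by
    rw [ipE_const_eq_cip hT hc, ipE_const_eq_qip hT, ipE_eq_qip hT]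
    simp [loadF, loadV, sub_eq_add_neg]
  constructor
  · intro H
    refine LinearMap.ext fun x => ?_
    rw [← h x.1 x.2, ← H x.1 x.2, formA_eq_formL S R hT hc]
  · intro H l χ
    rw [formA_eq_formL S R hT hc, h, H]

/-- The derivative `∂_t : R → ∂_t R`. -/
def dtMap : R →ₗ[ℝ] dtSpace R where
  toFun u := ⟨u.1.2, Submodule.mem_map_of_mem u.2⟩
  map_add' _ _ := rfl
  map_smul' _ _ := rfl

variable {S R} {n : ℕ} {φ : Module.Basis (Fin n) ℝ S} {s : Fin n → ℝ}

theorem formL_modal (hT : 0 < T) (hc : MemLp c ⊤ (muS Ω))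
    (h1 : ∀ i j, inner ℝ (φ i).1.1 (φ j).1.1 = if i = j then (1 : ℝ) else 0)
    (h2 : ∀ i j, wip (memLp_sq_top hc) (φ i).1.2 (φ j).1.2 = if i = j then s i else 0)
    (u v : Fin n → R) (l χ : Fin n → dtSpace R) :
    formL S R hT hc (∑ i, φ i ⊗ₜ[ℝ] u i, ∑ i, φ i ⊗ₜ[ℝ] v i)
        (∑ i, φ i ⊗ₜ[ℝ] l i, ∑ i, φ i ⊗ₜ[ℝ] χ i) =
      ∑ i, tip hT (v i).1.2 (l i) + ∑ i, s i * tip hT (u i).1.1 (l i)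
        - ∑ i, tip hT (u i).1.2 (χ i) + ∑ i, tip hT (v i).1.1 (χ i) := by
  rw [formL, LinearMap.mk₂_apply, trialDt, trialGrad, trialVal, testVal, testGrad,
    qip_valT hT h1, cip_gradT hT hc h2, qip_valT hT h1, qip_valT hT h1]
  rfl

/-- The first equation, tested with `λ = ∑ w_i φ_i ⊗ x_i'`. -/
theorem modal_first (hT : 0 < T) (hc : MemLp c ⊤ (muS Ω))
    (h1 : ∀ i j, inner ℝ (φ i).1.1 (φ j).1.1 = if i = j then (1 : ℝ) else 0)
    (h2 : ∀ i j, wip (memLp_sq_top hc) (φ i).1.2 (φ j).1.2 = if i = j then s i else 0)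
    {u v : Fin n → R} {ℓ m : TestSp S R →ₗ[ℝ] ℝ}
    (h : formL S R hT hc (∑ i, φ i ⊗ₜ[ℝ] u i, ∑ i, φ i ⊗ₜ[ℝ] v i) = ℓ.coprod m)
    (w : Fin n → ℝ) (x : Fin n → R) :
    ∑ i, w i * (tip hT (v i).1.2 (x i).1.2 + s i * tip hT (u i).1.1 (x i).1.2) =
      ℓ (∑ i, φ i ⊗ₜ[ℝ] (w i • dtMap R (x i))) := by
  have h0 := LinearMap.congr_fun h
    (∑ i, φ i ⊗ₜ[ℝ] (w i • dtMap R (x i)), ∑ i, φ i ⊗ₜ[ℝ] (0 : Fin n → dtSpace R) i)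
  rw [formL_modal hT hc h1 h2] at h0
  simp only [LinearMap.coprod_apply, Pi.zero_apply, TensorProduct.tmul_zero,
    Finset.sum_const_zero, map_zero, add_zero, Submodule.coe_zero, sub_zero, Submodule.coe_smul,
    map_smul, smul_eq_mul] at h0
  rw [← h0, ← Finset.sum_add_distrib]
  refine Finset.sum_congr rfl fun i _ => ?_
  simp only [dtMap, LinearMap.coe_mk, AddHom.coe_mk]
  ring

/-- The second equation, tested with `χ = ∑ w_i φ_i ⊗ x_i'`. -/
theorem modal_second (hT : 0 < T) (hc : MemLp c ⊤ (muS Ω))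
    (h1 : ∀ i j, inner ℝ (φ i).1.1 (φ j).1.1 = if i = j then (1 : ℝ) else 0)
    (h2 : ∀ i j, wip (memLp_sq_top hc) (φ i).1.2 (φ j).1.2 = if i = j then s i else 0)
    {u v : Fin n → R} {ℓ m : TestSp S R →ₗ[ℝ] ℝ}
    (h : formL S R hT hc (∑ i, φ i ⊗ₜ[ℝ] u i, ∑ i, φ i ⊗ₜ[ℝ] v i) = ℓ.coprod m)
    (w : Fin n → ℝ) (x : Fin n → R) :
    ∑ i, w i * (tip hT (v i).1.1 (x i).1.2 - tip hT (u i).1.2 (x i).1.2) =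
      m (∑ i, φ i ⊗ₜ[ℝ] (w i • dtMap R (x i))) := by
  have h0 := LinearMap.congr_fun h
    (∑ i, φ i ⊗ₜ[ℝ] (0 : Fin n → dtSpace R) i, ∑ i, φ i ⊗ₜ[ℝ] (w i • dtMap R (x i)))
  rw [formL_modal hT hc h1 h2] at h0
  simp only [LinearMap.coprod_apply, Pi.zero_apply, TensorProduct.tmul_zero,
    Finset.sum_const_zero, map_zero, zero_add, Submodule.coe_zero, mul_zero, Submodule.coe_smul,
    map_smul, smul_eq_mul] at h0
  rw [← h0, zero_sub, ← Finset.sum_neg_distrib, ← Finset.sum_add_distrib]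
  refine Finset.sum_congr rfl fun i _ => ?_
  simp only [dtMap, LinearMap.coe_mk, AddHom.coe_mk]
  ring

theorem eq_zero_of_deriv_eq_zero (hT : 0 < T) (hR : R ≤ H1Zero T) (r : R)
    (h : tip hT r.1.2 r.1.2 = 0) : r = 0 := by
  have h2 := eq_zero_of_tip_self_eq_zero hT h
  exact Subtype.ext (Prod.ext (H1Zero.fst_eq_zero hT (hR r.2) h2) h2)

/-- Uniqueness: testing with `(∂_t U, ∂_t V)` controls the energy, which vanishes without data. -/
theorem formL_injective (hΩ : IsOpen Ω) (hT : 0 < T) (hc : MemLp c ⊤ (muS Ω)) (hS : S ≤ H10 Ω)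
    [FiniteDimensional ℝ S] (hR : R ≤ H1Zero T) : Function.Injective (formL S R hT hc) := by
  refine (injective_iff_map_eq_zero _).2 ?_
  rintro ⟨U, V⟩ h
  obtain ⟨n, φ, s, h1, h2⟩ := exists_modal_basis hΩ hS hc
  obtain ⟨u, rfl⟩ := exists_sum_tmul φ U
  obtain ⟨v, rfl⟩ := exists_sum_tmul φ V
  have hs : ∀ i, 0 ≤ s i := fun i => by
    have := wip_self_nonneg (memLp_sq_top hc) (ae_of_all _ fun _ => sq_nonneg _) (φ i).1.2
    rwa [h2, if_pos rfl] at this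
  have h' : formL S R hT hc (∑ i, φ i ⊗ₜ[ℝ] u i, ∑ i, φ i ⊗ₜ[ℝ] v i) =
      (0 : TestSp S R →ₗ[ℝ] ℝ).coprod 0 := by
    rw [h]
    ext <;> simp
  have f1 : ∀ (i : Fin n) (x : R),
      tip hT (v i).1.2 x.1.2 + s i * tip hT (u i).1.1 x.1.2 = 0 := fun i x => by
    simpa using modal_first hT hc h1 h2 h' (fun j => if j = i then 1 else 0) (fun _ => x)
  have f2 : ∀ (i : Fin n) (x : R),
      tip hT (v i).1.1 x.1.2 - tip hT (u i).1.2 x.1.2 = 0 := fun i x => by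
    simpa using modal_second hT hc h1 h2 h' (fun j => if j = i then 1 else 0) (fun _ => x)
  have hv0 : ∀ i, tip hT (v i).1.1 (v i).1.1 = 0 := fun i => by
    have e1 := two_tip_deriv hT (hR (u i).2)
    have e2 := two_tip_deriv hT (hR (v i).2)
    have e3 : s i * (2 * tip hT (u i).1.1 (u i).1.2) + 2 * tip hT (v i).1.1 (v i).1.2 = 0 := by
      have := f1 i (u i)
      have := f2 i (v i)
      have := tip_comm hT (v i).1.2 (u i).1.2
      linarith
    have p1 : 0 ≤ tip hT (u i).1.1 (u i).1.1 / T := div_nonneg (tip_self_nonneg hT _) hT.le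
    have p2 : 0 ≤ tip hT (v i).1.1 (v i).1.1 / T := div_nonneg (tip_self_nonneg hT _) hT.le
    have p3 : 0 ≤ s i * (2 * tip hT (u i).1.1 (u i).1.2) :=
      mul_nonneg (hs i) (by rw [e1]; positivity)
    have p4 : 0 ≤ Real.exp (-1) * prim (v i).1 T ^ 2 := by positivity
    have p5 : tip hT (v i).1.1 (v i).1.1 / T = 0 := by linarith
    simpa [hT.ne'] using p5
  have hu : ∀ i, u i = 0 := fun i => by
    refine eq_zero_of_deriv_eq_zero hT hR _ ?_
    have := f2 i (u i)
    rw [eq_zero_of_tip_self_eq_zero hT (hv0 i)] at this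
    simpa using this
  have hv : ∀ i, v i = 0 := fun i => by
    refine eq_zero_of_deriv_eq_zero hT hR _ ?_
    have := f1 i (v i)
    rw [hu i] at this
    simpa using this
  simp [hu, hv]

theorem bijective_of_injective_of_finrank_eq {V V' : Type*} [AddCommGroup V] [Module ℝ V]
    [AddCommGroup V'] [Module ℝ V'] [FiniteDimensional ℝ V] [FiniteDimensional ℝ V']
    (B : V →ₗ[ℝ] V' →ₗ[ℝ] ℝ) (h : Module.finrank ℝ V = Module.finrank ℝ V')
    (hB : Function.Injective B) : Function.Bijective B :=
  ⟨hB, (LinearMap.injective_iff_surjective_of_finrank_eq_finrank (V₂ := Module.Dual ℝ V') (f := B)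
    (h.trans Subspace.dual_finrank_eq.symm)).1 hB⟩

/-- The discrete problem is a square linear system, hence uniquely solvable for all data. -/
theorem formL_bijective (hΩ : IsOpen Ω) (hT : 0 < T) (hc : MemLp c ⊤ (muS Ω)) (hS : S ≤ H10 Ω)
    [FiniteDimensional ℝ S] (hR : R ≤ H1Zero T) [FiniteDimensional ℝ R] :
    Function.Bijective (formL S R hT hc) := by
  have hinj := formL_injective hΩ hT hc hS hR
  have hdt : Module.finrank ℝ (dtSpace R) = Module.finrank ℝ R := by
    refine (LinearEquiv.finrank_eq (LinearEquiv.ofBijective (dtMap R) ⟨?_, ?_⟩)).symm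
    · rw [← LinearMap.ker_eq_bot, LinearMap.ker_eq_bot']
      intro r hr
      refine eq_zero_of_deriv_eq_zero hT hR r ?_
      rw [show r.1.2 = 0 from congrArg Subtype.val hr, map_zero]
    · rintro ⟨_, r, hr, rfl⟩
      exact ⟨⟨r, hr⟩, rfl⟩
  have : FiniteDimensional ℝ (dtSpace R) := by unfold dtSpace; infer_instance
  have : FiniteDimensional ℝ (TestSp S R × TestSp S R) := inferInstance
  have : FiniteDimensional ℝ (Trial S R × Trial S R) := inferInstance
  refine bijective_of_injective_of_finrank_eq (V := Trial S R × Trial S R)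
    (V' := TestSp S R × TestSp S R) (formL S R hT hc) ?_ hinj
  rw [Module.finrank_prod, Module.finrank_prod, Module.finrank_tensorProduct,
    Module.finrank_tensorProduct, hdt]

/-- The squared discrete norm in modal coordinates; the discrete Newton potential acts on the mode
`φ_i` as division by `s_i`. -/
theorem normVeh_sq_modal (hT : 0 < T) (hc : MemLp c ⊤ (muS Ω))
    (h1 : ∀ i j, inner ℝ (φ i).1.1 (φ j).1.1 = if i = j then (1 : ℝ) else 0)
    (h2 : ∀ i j, wip (memLp_sq_top hc) (φ i).1.2 (φ j).1.2 = if i = j then s i else 0)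
    (hs : ∀ i, 0 < s i) (u v : Fin n → R) :
    normVeh S R c (∑ i, φ i ⊗ₜ[ℝ] u i, ∑ i, φ i ⊗ₜ[ℝ] v i) ^ 2 =
      ∑ i, (tip hT (u i).1.2 (u i).1.2 + (s i)⁻¹ * tip hT (v i).1.2 (v i).1.2
        + s i * tip hT (u i).1.1 (u i).1.1 + tip hT (v i).1.1 (v i).1.1) := by
  have hN : normN S c (trialDt S R (∑ i, φ i ⊗ₜ[ℝ] v i)) ^ 2 =
      ∑ i, (s i)⁻¹ * tip hT (v i).1.2 (v i).1.2 := by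
    have hex : ∃ N, IsDiscreteNewton S c (trialDt S R (∑ i, φ i ⊗ₜ[ℝ] v i)) N := by
      refine ⟨∑ i, φ i ⊗ₜ[ℝ] ((s i)⁻¹ • (v i).1.2), fun Z => ?_⟩
      obtain ⟨z, rfl⟩ := exists_sum_tmul φ Z
      rw [ipE_eq_cip hT hc, ipE_eq_qip hT, cip_gradT hT hc h2, trialDt, qip_valT hT h1]
      refine Finset.sum_congr rfl fun i _ => ?_
      simp [(hs i).ne']
    have hdef : discreteNewton S c (trialDt S R (∑ i, φ i ⊗ₜ[ℝ] v i)) = hex.choose := by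
      rw [discreteNewton, dif_pos hex]
    have hspec := hex.choose_spec
    obtain ⟨m, hm⟩ := exists_sum_tmul φ hex.choose
    rw [normN, hdef, normE_sq_eq_cip hT hc]
    rw [hm] at hspec ⊢
    have key : ∀ i (z : L2T T), s i * tip hT (m i) z = tip hT (v i).1.2 z := by
      intro i z
      have h := hspec (∑ j, φ j ⊗ₜ[ℝ] (Pi.single i z : Fin n → L2T T) j)
      rw [ipE_eq_cip hT hc, ipE_eq_qip hT, cip_gradT hT hc h2, trialDt, qip_valT hT h1] at h
      rw [Finset.sum_eq_single i (fun j _ hj => by simp [Pi.single_eq_of_ne hj]) (by simp),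
        Finset.sum_eq_single i (fun j _ hj => by simp [Pi.single_eq_of_ne hj]) (by simp)] at h
      simpa using h
    rw [cip_gradT hT hc h2]
    refine Finset.sum_congr rfl fun i _ => ?_
    simp only [LinearMap.id_apply]
    rw [key, ← key i (v i).1.2, tip_comm hT (m i), inv_mul_cancel_left₀ (hs i).ne']
  rw [normVeh, Real.sq_sqrt (by positivity), normE_sq_eq_qip hT, normE_sq_eq_qip hT, hN,
    normE_sq_eq_cip hT hc, trialDt, trialGrad, trialVal, qip_valT hT h1, qip_valT hT h1,
    cip_gradT hT hc h2]
  simp only [Finset.sum_add_distrib]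
  rfl

end Discrete

/-! ### Stability -/

section Stability

/-- Minkowski's inequality for a positive semidefinite symmetric form. -/
theorem sqrt_form_add_le {V : Type*} [AddCommGroup V] [Module ℝ V] (B : LinearMap.BilinForm ℝ V)
    (h0 : ∀ x, 0 ≤ B x x) (hs : ∀ x y, B x y = B y x) (x y : V) :
    √(B (x + y) (x + y)) ≤ √(B x x) + √(B y y) := by
  have h := B.apply_mul_apply_le_of_forall_zero_le h0 x y
  rw [hs y x] at h
  have h2 : B x y ≤ √(B x x) * √(B y y) := by
    rw [← Real.sqrt_mul (h0 x)]
    exact Real.le_sqrt_of_sq_le (by rwa [sq])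
  refine Real.sqrt_le_iff.2 ⟨by positivity, ?_⟩
  rw [map_add B, LinearMap.add_apply, map_add, map_add, hs y x, add_sq, Real.sq_sqrt (h0 x),
    Real.sq_sqrt (h0 y)]
  linarith

/-- Cauchy-Schwarz for a weighted sum over the modes. -/
theorem abs_sum_tip_le {T : ℝ} (hT : 0 < T) {ι : Type*} [Fintype ι] {w : ι → ℝ} (hw : ∀ i, 0 ≤ w i)
    (f g : ι → L2T T) :
    |∑ i, w i * tip hT (f i) (g i)| ≤
      √(∑ i, w i * tip hT (f i) (f i)) * √(∑ i, w i * tip hT (g i) (g i)) := by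
  let B : LinearMap.BilinForm ℝ (ι → L2T T) :=
    ∑ i, w i • (tip hT).compl₁₂ (LinearMap.proj i) (LinearMap.proj i)
  have hB : ∀ f g, B f g = ∑ i, w i * tip hT (f i) (g i) := fun f g => by simp [B]
  have h0 : ∀ f, 0 ≤ B f f := fun f => by
    rw [hB]
    exact Finset.sum_nonneg fun i _ => mul_nonneg (hw i) (tip_self_nonneg hT _)
  have h := B.apply_mul_apply_le_of_forall_zero_le h0 f g
  have hs : B g f = B f g := by simp only [hB, tip_comm hT (g _)]
  rw [hs, ← sq] at h
  rw [← hB, ← hB, ← hB, ← Real.sqrt_mul (h0 f), ← Real.sqrt_sq_eq_abs]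
  exact Real.sqrt_le_sqrt h

variable {d : ℕ} {Ω : Set (Sp d)} {T : ℝ} {c : Sp d → ℝ}

theorem normS_eq_norm {E : Type*} [NormedAddCommGroup E] [InnerProductSpace ℝ E]
    (f : Lp E 2 (muS Ω)) : normS Ω f = ‖f‖ := by
  rw [normS, ← Real.sqrt_sq (norm_nonneg f), ← real_inner_self_eq_norm_sq, L2.inner_def]
  simp only [real_inner_self_eq_norm_sq]

theorem normS_nonneg {E : Type*} [NormedAddCommGroup E] (f : Sp d → E) : 0 ≤ normS Ω f :=
  Real.sqrt_nonneg _

/-- The Poincaré inequality with the weighted gradient norm. -/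
theorem IsPoincareConst.norm_sq_le {C c₀ : ℝ} (hC : IsPoincareConst Ω C) (hc₀ : 0 < c₀)
    (hc : MemLp c ⊤ (muS Ω)) (hcc₀ : ∀ᵐ x ∂(muS Ω), c₀ ≤ c x) {p : L2S Ω × L2SVec Ω}
    (hp : p ∈ H10 Ω) : ‖p.1‖ ^ 2 ≤ (C / c₀) ^ 2 * wip (memLp_sq_top hc) p.2 p.2 := by
  have h1 := hC.2 p hp
  rw [normS_eq_norm, normS_eq_norm] at h1
  have h2 : c₀ ^ 2 * ‖p.2‖ ^ 2 ≤ wip (memLp_sq_top hc) p.2 p.2 := by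
    rw [← real_inner_self_eq_norm_sq, ← wip_const (μ := muS Ω) (c₀ ^ 2) (memLp_top_const _)]
    refine wip_mono _ _ ?_ _
    filter_upwards [hcc₀] with x hx
    exact pow_le_pow_left₀ hc₀.le hx 2
  calc ‖p.1‖ ^ 2 ≤ (C * ‖p.2‖) ^ 2 := pow_le_pow_left₀ (norm_nonneg _) h1 2
    _ = (C / c₀) ^ 2 * (c₀ ^ 2 * ‖p.2‖ ^ 2) := by field_simp
    _ ≤ _ := mul_le_mul_of_nonneg_left h2 (sq_nonneg _)

theorem normS_smul_sq (hc : MemLp c ⊤ (muS Ω)) (G : L2SVec Ω) :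
    normS Ω (fun x => c x • G x) ^ 2 = wip (memLp_sq_top hc) G G := by
  have h : ∫ x, ‖c x • G x‖ ^ 2 ∂(muS Ω) = wip (memLp_sq_top hc) G G := by
    rw [wip_apply]
    refine integral_congr_ae (ae_of_all _ fun x => ?_)
    simp only [← real_inner_self_eq_norm_sq, real_inner_smul_left, real_inner_smul_right]
    ring
  rw [normS, h, Real.sq_sqrt (wip_self_nonneg _ (ae_of_all _ fun _ => sq_nonneg _) G)]

theorem IsPoincareConst.norm_le {C c₀ : ℝ} (hC : IsPoincareConst Ω C) (hc₀ : 0 < c₀)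
    (hc : MemLp c ⊤ (muS Ω)) (hcc₀ : ∀ᵐ x ∂(muS Ω), c₀ ≤ c x) {p : L2S Ω × L2SVec Ω}
    (hp : p ∈ H10 Ω) : ‖p.1‖ ≤ C / c₀ * normS Ω (fun x => c x • p.2 x) := by
  have h := hC.norm_sq_le hc₀ hc hcc₀ hp
  rw [← normS_smul_sq hc, ← mul_pow] at h
  exact (abs_le_of_sq_le_sq' h (mul_nonneg (div_pos hC.1 hc₀).le (normS_nonneg _))).2

variable {S : Submodule ℝ (L2S Ω × L2SVec Ω)} {R : Submodule ℝ (L2T T × L2T T)}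
  {n : ℕ} {φ : Module.Basis (Fin n) ℝ S} {s : Fin n → ℝ}

theorem normVeh_nonneg (W : Trial S R × Trial S R) : 0 ≤ normVeh S R c W := Real.sqrt_nonneg _

theorem normVeh_add_le (hT : 0 < T) (hc : MemLp c ⊤ (muS Ω))
    (h1 : ∀ i j, inner ℝ (φ i).1.1 (φ j).1.1 = if i = j then (1 : ℝ) else 0)
    (h2 : ∀ i j, wip (memLp_sq_top hc) (φ i).1.2 (φ j).1.2 = if i = j then s i else 0)
    (hs : ∀ i, 0 < s i) (W W' : Trial S R × Trial S R) :
    normVeh S R c (W + W') ≤ normVeh S R c W + normVeh S R c W' := by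
  let B : LinearMap.BilinForm ℝ ((Fin n → R) × (Fin n → R)) :=
    LinearMap.mk₂ ℝ (fun x y => ∑ i,
      (tip hT (x.1 i).1.2 (y.1 i).1.2 + (s i)⁻¹ * tip hT (x.2 i).1.2 (y.2 i).1.2
        + s i * tip hT (x.1 i).1.1 (y.1 i).1.1 + tip hT (x.2 i).1.1 (y.2 i).1.1))
      (fun x y z => by
        rw [← Finset.sum_add_distrib]
        refine Finset.sum_congr rfl fun i _ => ?_
        simp only [Prod.fst_add, Prod.snd_add, Pi.add_apply, Submodule.coe_add, map_add,
          LinearMap.add_apply]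
        ring)
      (fun a x z => by
        rw [Finset.smul_sum]
        refine Finset.sum_congr rfl fun i _ => ?_
        simp only [Prod.smul_fst, Prod.smul_snd, Pi.smul_apply, Submodule.coe_smul, map_smul,
          LinearMap.smul_apply, smul_eq_mul]
        ring)
      (fun x y z => by
        rw [← Finset.sum_add_distrib]
        refine Finset.sum_congr rfl fun i _ => ?_
        simp only [Prod.fst_add, Prod.snd_add, Pi.add_apply, Submodule.coe_add, map_add]
        ring)
      (fun a x z => by
        rw [Finset.smul_sum]
        refine Finset.sum_congr rfl fun i _ => ?_
        simp only [Prod.smul_fst, Prod.smul_snd, Pi.smul_apply, Submodule.coe_smul, map_smul,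
          smul_eq_mul]
        ring)
  have hB0 : ∀ x, 0 ≤ B x x := fun x => by
    rw [LinearMap.mk₂_apply]
    refine Finset.sum_nonneg fun i _ => ?_
    have p1 := tip_self_nonneg hT (x.1 i).1.2
    have p2 := mul_nonneg (inv_nonneg.2 (hs i).le) (tip_self_nonneg hT (x.2 i).1.2)
    have p3 := mul_nonneg (hs i).le (tip_self_nonneg hT (x.1 i).1.1)
    have p4 := tip_self_nonneg hT (x.2 i).1.1
    linarith
  have hBs : ∀ x y, B x y = B y x := fun x y => by
    rw [LinearMap.mk₂_apply, LinearMap.mk₂_apply]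
    refine Finset.sum_congr rfl fun i _ => ?_
    simp only [tip_comm hT (x.1 i).1.2, tip_comm hT (x.2 i).1.2, tip_comm hT (x.1 i).1.1,
      tip_comm hT (x.2 i).1.1]
  have hB : ∀ u v : Fin n → R,
      normVeh S R c (∑ i, φ i ⊗ₜ[ℝ] u i, ∑ i, φ i ⊗ₜ[ℝ] v i) = √(B (u, v) (u, v)) := fun u v => by
    rw [← Real.sqrt_sq (normVeh_nonneg _), normVeh_sq_modal hT hc h1 h2 hs]
    rfl
  obtain ⟨U, V⟩ := W
  obtain ⟨U', V'⟩ := W'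
  obtain ⟨u, rfl⟩ := exists_sum_tmul φ U
  obtain ⟨v, rfl⟩ := exists_sum_tmul φ V
  obtain ⟨u', rfl⟩ := exists_sum_tmul φ U'
  obtain ⟨v', rfl⟩ := exists_sum_tmul φ V'
  have hadd : ((∑ i, φ i ⊗ₜ[ℝ] u i, ∑ i, φ i ⊗ₜ[ℝ] v i) : Trial S R × Trial S R)
      + (∑ i, φ i ⊗ₜ[ℝ] u' i, ∑ i, φ i ⊗ₜ[ℝ] v' i) =
      (∑ i, φ i ⊗ₜ[ℝ] (u + u') i, ∑ i, φ i ⊗ₜ[ℝ] (v + v') i) := by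
    simp only [Prod.mk_add_mk, Pi.add_apply, TensorProduct.tmul_add, Finset.sum_add_distrib]
  rw [hadd, hB, hB, hB]
  exact sqrt_form_add_le B hB0 hBs (u, v) (u', v')

/-- Stability with respect to a functional on the first equation that is bounded by `X` in
`L²_e(Q_T)`. -/
theorem normVeh_le_of_first (hT : 0 < T) (hc : MemLp c ⊤ (muS Ω)) (hR : R ≤ H1Zero T)
    (h1 : ∀ i j, inner ℝ (φ i).1.1 (φ j).1.1 = if i = j then (1 : ℝ) else 0)
    (h2 : ∀ i j, wip (memLp_sq_top hc) (φ i).1.2 (φ j).1.2 = if i = j then s i else 0)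
    (hs : ∀ i, 0 < s i) {κ : ℝ} (hκ : 0 ≤ κ) (hsκ : ∀ i, 1 ≤ κ ^ 2 * s i)
    {ℓ : TestSp S R →ₗ[ℝ] ℝ} {X : ℝ} (hX : 0 ≤ X)
    (hℓ : ∀ l, |ℓ l| ≤ X * √(qip hT (testVal S R l) (testVal S R l)))
    {W : Trial S R × Trial S R} (hW : formL S R hT hc W = ℓ.coprod 0) :
    normVeh S R c W ≤ 2 * √(κ ^ 2 + 4 * T ^ 2) * X := by
  obtain ⟨U, V⟩ := W
  obtain ⟨u, rfl⟩ := exists_sum_tmul φ U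
  obtain ⟨v, rfl⟩ := exists_sum_tmul φ V
  have hℓ' : ∀ (w : Fin n → ℝ) (x : Fin n → R), |ℓ (∑ i, φ i ⊗ₜ[ℝ] (w i • dtMap R (x i)))| ≤
      X * √(∑ i, w i ^ 2 * tip hT (x i).1.2 (x i).1.2) := fun w x => by
    refine (hℓ _).trans_eq ?_
    rw [testVal, qip_valT hT h1]
    congr 2
    refine Finset.sum_congr rfl fun i _ => ?_
    simp only [map_smul, LinearMap.smul_apply, smul_eq_mul, dtMap, LinearMap.coe_mk, AddHom.coe_mk,
      Submodule.subtype_apply]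
    ring
  have f1 := modal_first hT hc h1 h2 hW
  have f2 := modal_second hT hc h1 h2 hW
  simp only [LinearMap.zero_apply] at f2
  set A := ∑ i, tip hT (u i).1.2 (u i).1.2 with hA
  set N := ∑ i, (s i)⁻¹ * tip hT (v i).1.2 (v i).1.2 with hN
  set P := ∑ i, s i * tip hT (u i).1.1 (u i).1.1 with hP
  set Q := ∑ i, tip hT (v i).1.1 (v i).1.1 with hQ
  have hinv : ∀ i, 0 ≤ (s i)⁻¹ := fun i => inv_nonneg.2 (hs i).le
  have hN0 : 0 ≤ N :=
    Finset.sum_nonneg fun i _ => mul_nonneg (hinv i) (tip_self_nonneg hT _)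
  have key : A + N + P + Q ≤ 4 * (κ ^ 2 + 4 * T ^ 2) * X ^ 2 := by
    refine energy_bound hT hX hκ (Finset.sum_nonneg fun i _ => tip_self_nonneg hT _) hN0
      (Finset.sum_nonneg fun i _ => mul_nonneg (hs i).le (tip_self_nonneg hT _))
      (Finset.sum_nonneg fun i _ => tip_self_nonneg hT _) ?_ ?_ ?_
    · -- `λ = ∂_t U`, `χ = ∂_t V`
      have g1 := f1 (fun _ => 1) u
      have g2 := f2 (fun _ => 1) v
      have g3 := hℓ' (fun _ => 1) u
      simp only [one_mul, one_pow] at g1 g2 g3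
      rw [← hA] at g3
      have g4 : (P + Q) / T ≤ 2 * ∑ i, (s i * tip hT (u i).1.1 (u i).1.2
          + tip hT (v i).1.1 (v i).1.2) := by
        rw [hP, hQ, ← Finset.sum_add_distrib, Finset.sum_div, Finset.mul_sum]
        refine Finset.sum_le_sum fun i _ => ?_
        have e1 := two_tip_deriv hT (hR (u i).2)
        have e2 := two_tip_deriv hT (hR (v i).2)
        have e3 : 0 ≤ s i * (Real.exp (-1) * prim (u i).1 T ^ 2) :=
          mul_nonneg (hs i).le (by positivity)
        have e4 : 0 ≤ Real.exp (-1) * prim (v i).1 T ^ 2 := by positivity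
        have e5 : 2 * (s i * tip hT (u i).1.1 (u i).1.2 + tip hT (v i).1.1 (v i).1.2) =
            s i * (Real.exp (-1) * prim (u i).1 T ^ 2) + Real.exp (-1) * prim (v i).1 T ^ 2
              + (s i * tip hT (u i).1.1 (u i).1.1 + tip hT (v i).1.1 (v i).1.1) / T := by
          rw [mul_add, mul_left_comm, e1, e2]
          ring
        rw [e5]
        linarith
      have g5 : ∑ i, (s i * tip hT (u i).1.1 (u i).1.2 + tip hT (v i).1.1 (v i).1.2) =
          ℓ (∑ i, φ i ⊗ₜ[ℝ] ((1 : ℝ) • dtMap R (u i))) := by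
        rw [← g1, ← add_zero (∑ i, (tip hT (v i).1.2 (u i).1.2 + _)), ← g2,
          ← Finset.sum_add_distrib]
        refine Finset.sum_congr rfl fun i _ => ?_
        rw [tip_comm hT (v i).1.2]
        ring
      rw [g5, div_le_iff₀ hT] at g4
      have g6 := mul_le_mul_of_nonneg_left ((le_abs_self _).trans g3) hT.le
      linarith
    · -- `χ = ∂_t U`
      have g2 := f2 (fun _ => 1) u
      simp only [one_mul, Finset.sum_sub_distrib] at g2
      have g3 := (le_abs_self _).trans (abs_sum_tip_le hT (w := fun _ => 1)
        (fun _ => zero_le_one) (fun i => (v i).1.1) (fun i => (u i).1.2))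
      simp only [one_mul] at g3
      linarith
    · -- `λ = N_h ∂_t V`
      have g1 := f1 (fun i => (s i)⁻¹) v
      have g3 := (le_abs_self _).trans (hℓ' (fun i => (s i)⁻¹) v)
      rw [← g1] at g3
      have g4 : ∑ i, (s i)⁻¹ * (tip hT (v i).1.2 (v i).1.2 + s i * tip hT (u i).1.1 (v i).1.2) =
          N + ∑ i, s i * tip hT (u i).1.1 ((s i)⁻¹ • (v i).1.2) := by
        rw [hN, ← Finset.sum_add_distrib]
        refine Finset.sum_congr rfl fun i _ => ?_
        rw [map_smul, smul_eq_mul]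
        ring
      have g5 := (neg_le_abs _).trans (abs_sum_tip_le hT (fun i => (hs i).le)
        (fun i => (u i).1.1) (fun i => (s i)⁻¹ • (v i).1.2))
      have g6 : ∑ i, s i * tip hT ((s i)⁻¹ • (v i).1.2) ((s i)⁻¹ • (v i).1.2) = N := by
        refine Finset.sum_congr rfl fun i _ => ?_
        simp only [map_smul, LinearMap.smul_apply, smul_eq_mul]
        rw [mul_inv_cancel_left₀ (hs i).ne']
      have g7 : √(∑ i, (s i)⁻¹ ^ 2 * tip hT (v i).1.2 (v i).1.2) ≤ κ * √N := by
        rw [← Real.sqrt_sq hκ, ← Real.sqrt_mul (sq_nonneg κ)]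
        refine Real.sqrt_le_sqrt ?_
        rw [hN, Finset.mul_sum]
        refine Finset.sum_le_sum fun i _ => ?_
        rw [sq, mul_assoc, ← mul_assoc (κ ^ 2)]
        rw [← mul_assoc]
        refine mul_le_mul_of_nonneg_right ?_ (tip_self_nonneg hT _)
        refine mul_le_mul_of_nonneg_right ?_ (hinv i)
        rw [inv_le_iff_one_le_mul₀ (hs i)]
        exact hsκ i
      rw [g6] at g5
      have g8 := mul_le_mul_of_nonneg_left g7 hX
      linarith
  refine abs_le_of_sq_le_sq' ?_ (by positivity) |>.2
  rw [normVeh_sq_modal hT hc h1 h2 hs]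
  simp only [Finset.sum_add_distrib]
  rw [mul_pow, mul_pow, Real.sq_sqrt (by positivity)]
  linarith

/-- Stability with respect to the initial velocity: only `V₀ ∈ L²(Ω)` is needed, and the constant
depends on `T` alone. -/
theorem normVeh_le_of_second (hT : 0 < T) (hc : MemLp c ⊤ (muS Ω)) (hR : R ≤ H1Zero T)
    (h1 : ∀ i j, inner ℝ (φ i).1.1 (φ j).1.1 = if i = j then (1 : ℝ) else 0)
    (h2 : ∀ i j, wip (memLp_sq_top hc) (φ i).1.2 (φ j).1.2 = if i = j then s i else 0)
    (hs : ∀ i, 0 < s i) {V₀ : L2S Ω} {W : Trial S R × Trial S R}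
    (hW : formL S R hT hc W = (0 : TestSp S R →ₗ[ℝ] ℝ).coprod (loadV S R hT V₀)) :
    normVeh S R c W ≤ 2 * √T * ‖V₀‖ := by
  obtain ⟨U, V⟩ := W
  obtain ⟨u, rfl⟩ := exists_sum_tmul φ U
  obtain ⟨v, rfl⟩ := exists_sum_tmul φ V
  have f1 : ∀ (i : Fin n) (x : R),
      tip hT (v i).1.2 x.1.2 + s i * tip hT (u i).1.1 x.1.2 = 0 := fun i x => by
    simpa using modal_first hT hc h1 h2 hW (fun j => if j = i then 1 else 0) (fun _ => x)
  have hload : ∀ χ : Fin n → dtSpace R, loadV S R hT V₀ (∑ i, φ i ⊗ₜ[ℝ] χ i) =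
      -∑ i, inner ℝ (φ i).1.1 V₀ * tip hT (oneT T) (χ i) := fun χ => by
    rw [loadV, LinearMap.neg_apply, LinearMap.comp_apply, testVal, valT_sum, map_sum]
    simp only [qip_prodLp, Submodule.subtype_apply, real_inner_comm]
  have f2 : ∀ (i : Fin n) (x : R), tip hT (u i).1.2 x.1.2 =
      tip hT (v i).1.1 x.1.2 + inner ℝ (φ i).1.1 V₀ * tip hT (oneT T) x.1.2 := fun i x => by
    have h := modal_second hT hc h1 h2 hW (fun j => if j = i then 1 else 0) (fun _ => x)
    rw [hload] at h
    have h' : tip hT (v i).1.1 x.1.2 - tip hT (u i).1.2 x.1.2 =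
        -(inner ℝ (φ i).1.1 V₀ * tip hT (oneT T) x.1.2) := by
      simpa [dtMap, ite_smul, apply_ite] using h
    linarith
  have hbessel : ∑ i, inner ℝ (φ i).1.1 V₀ ^ 2 ≤ ‖V₀‖ ^ 2 := by
    have ho : Orthonormal ℝ (fun i => (φ i).1.1) := orthonormal_iff_ite.2 h1
    have := ho.sum_inner_products_le V₀ (s := Finset.univ)
    simpa using this
  refine abs_le_of_sq_le_sq' ?_ (by positivity) |>.2
  rw [normVeh_sq_modal hT hc h1 h2 hs]
  calc _ ≤ ∑ i, 4 * T * inner ℝ (φ i).1.1 V₀ ^ 2 := Finset.sum_le_sum fun i _ =>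
        mode_bound hT (hR (u i).2) (hR (v i).2) (hs i) (f1 i (u i)) (f1 i (v i)) (f2 i (u i))
          (f2 i (v i))
    _ ≤ 4 * T * ‖V₀‖ ^ 2 := by
        rw [← Finset.mul_sum]
        exact mul_le_mul_of_nonneg_left hbessel (by positivity)
    _ = _ := by
        rw [mul_pow, mul_pow, Real.sq_sqrt hT.le]
        norm_num

/-- With `g = ∇ · (c² ∇U₀) ∈ L²(Ω)` the first right hand side is bounded in `L²_e(Q_T)`. -/
theorem abs_loadF_le (hT : 0 < T) (hc : MemLp c ⊤ (muS Ω)) (hS : S ≤ H10 Ω) (F : L2Q Ω T)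
    {G : L2SVec Ω} {g : L2S Ω} (hg : IsWeakDiv Ω (fun x => c x ^ 2 • G x) g) (l : TestSp S R) :
    |loadF S R hT hc F G l| ≤ (normE Ω T F + √T * normS Ω g) *
      √(qip hT (testVal S R l) (testVal S R l)) := by
  have hdiv : cip hT hc (prodLp (muS Ω) (muT T) G (oneT T)) (testGrad S R l) =
      -qip hT (prodLp (muS Ω) (muT T) g (oneT T)) (testVal S R l) := by
    induction l using TensorProduct.induction_on with
    | zero => simp
    | tmul x y =>
      have h1 : testGrad S R (x ⊗ₜ[ℝ] y) = prodLp (muS Ω) (muT T) x.1.2 y := rfl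
      have h2 : testVal S R (x ⊗ₜ[ℝ] y) = prodLp (muS Ω) (muT T) x.1.1 y := rfl
      rw [h1, h2, cip_prodLp, qip_prodLp, hg.inner_eq hc (hS x.2), neg_mul]
    | add x y hx hy => rw [map_add, map_add, map_add, map_add, hx, hy, neg_add]
  have h0 : ∀ᵐ z ∂(muQ Ω T), 0 ≤ Real.exp (-z.2 / T) := ae_of_all _ fun _ => (Real.exp_pos _).le
  have e1 : |qip hT F (testVal S R l)| ≤
      √(qip hT F F) * √(qip hT (testVal S R l) (testVal S R l)) := abs_wip_le _ h0 _ _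
  have e2 : |qip hT (prodLp (muS Ω) (muT T) g (oneT T)) (testVal S R l)| ≤
      √(qip hT (prodLp (muS Ω) (muT T) g (oneT T)) (prodLp (muS Ω) (muT T) g (oneT T))) *
        √(qip hT (testVal S R l) (testVal S R l)) := abs_wip_le _ h0 _ _
  have e3 : √(qip hT (prodLp (muS Ω) (muT T) g (oneT T)) (prodLp (muS Ω) (muT T) g (oneT T))) ≤
      √T * normS Ω g := by
    rw [normS_eq_norm, qip_prodLp, tip_oneT, real_inner_self_eq_norm_sq,
      ← Real.sqrt_sq (norm_nonneg g), ← Real.sqrt_mul hT.le, Real.sqrt_sq (norm_nonneg g)]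
    refine Real.sqrt_le_sqrt ?_
    have : 0 ≤ ‖g‖ ^ 2 * T * Real.exp (-1) := by positivity
    linarith
  have e4 : loadF S R hT hc F G l = qip hT F (testVal S R l)
      + qip hT (prodLp (muS Ω) (muT T) g (oneT T)) (testVal S R l) := by
    rw [loadF, LinearMap.sub_apply, LinearMap.comp_apply, LinearMap.comp_apply, hdiv,
      sub_neg_eq_add]
  rw [e4, add_mul, show normE Ω T F = √(qip hT F F) from rfl]
  exact (abs_add_le _ _).trans (add_le_add e1
    (e2.trans (mul_le_mul_of_nonneg_right e3 (Real.sqrt_nonneg _))))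

end Stability

end WaveDisc

end

theorem mainTheorem4 {d : ℕ} (hd : 1 ≤ d)
    -- the space domain and the final time
    (Ω : Set (WaveDisc.Sp d)) (hΩo : IsOpen Ω) (hΩb : Bornology.IsBounded Ω)
    (T : ℝ) (hT : 0 < T)
    -- the wave velocity
    (c : WaveDisc.Sp d → ℝ) (c₀ : ℝ) (hc₀ : 0 < c₀)
    (hc : MemLp c ⊤ (WaveDisc.muS Ω)) (hcc₀ : ∀ᵐ x ∂(WaveDisc.muS Ω), c₀ ≤ c x)
    -- the discrete spaces in space and time: arbitrary finite dimensional conforming spaces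
    (S : Submodule ℝ (WaveDisc.L2S Ω × WaveDisc.L2SVec Ω)) (hS : S ≤ WaveDisc.H10 Ω)
    [FiniteDimensional ℝ S]
    (R : Submodule ℝ (WaveDisc.L2T T × WaveDisc.L2T T)) (hR : R ≤ WaveDisc.H1Zero T)
    [FiniteDimensional ℝ R]
    -- the data
    (U₀ : WaveDisc.L2S Ω × WaveDisc.L2SVec Ω) (hU₀ : U₀ ∈ WaveDisc.H10 Ω)
    (V₀ : WaveDisc.L2S Ω) (F : WaveDisc.L2Q Ω T) :
    (∃! W : WaveDisc.Trial S R × WaveDisc.Trial S R,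
      WaveDisc.IsDiscreteSolution S R c U₀ V₀ F W) ∧
    -- stability, for `V₀ ∈ H¹₀(Ω)` and `g = ∇ · (c² ∇U₀) ∈ L²(Ω)`
    ∀ (gradV₀ : WaveDisc.L2SVec Ω), (V₀, gradV₀) ∈ WaveDisc.H10 Ω →
    ∀ (g : WaveDisc.L2S Ω), WaveDisc.IsWeakDiv Ω (fun x => c x ^ 2 • U₀.2 x) g →
    ∀ (CΩ : ℝ), WaveDisc.IsPoincareConst Ω CΩ →
    ∀ W : WaveDisc.Trial S R × WaveDisc.Trial S R,
      WaveDisc.IsDiscreteSolution S R c U₀ V₀ F W →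
      WaveDisc.normVeh S R c W ≤
        2 * Real.sqrt (CΩ ^ 2 / c₀ ^ 2 + 4 * T ^ 2) *
          (WaveDisc.normE Ω T F + Real.sqrt T * WaveDisc.normS Ω g
            + Real.sqrt T * WaveDisc.normS Ω (fun x => c x • gradV₀ x)) := by
  have hbij := WaveDisc.formL_bijective (R := R) hΩo hT hc hS hR
  refine ⟨?_, ?_⟩
  · simp only [WaveDisc.isDiscreteSolution_iff S R hT hc]
    exact hbij.existsUnique _
  intro gradV₀ hV₀ g hg CΩ hCΩ W hW
  rw [WaveDisc.isDiscreteSolution_iff S R hT hc] at hW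
  obtain ⟨n, φ, s, h1, h2⟩ := WaveDisc.exists_modal_basis hΩo hS hc
  have hκ : 0 < CΩ / c₀ := div_pos hCΩ.1 hc₀
  have hsκ : ∀ i, 1 ≤ (CΩ / c₀) ^ 2 * s i := fun i => by
    have h := hCΩ.norm_sq_le hc₀ hc hcc₀ (hS (φ i).2)
    rwa [h2, if_pos rfl, ← real_inner_self_eq_norm_sq, h1, if_pos rfl] at h
  have hs : ∀ i, 0 < s i := fun i =>
    pos_of_mul_pos_right (zero_lt_one.trans_le (hsκ i)) (sq_nonneg _)
  -- the solution is the sum of the responses to `F`, `U₀` and to `V₀`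
  obtain ⟨W₁, hW₁⟩ := hbij.2 ((WaveDisc.loadF S R hT hc F U₀.2).coprod 0)
  obtain ⟨W₂, hW₂⟩ := hbij.2
    ((0 : WaveDisc.TestSp S R →ₗ[ℝ] ℝ).coprod (WaveDisc.loadV S R hT V₀))
  have hsum : W = W₁ + W₂ := by
    refine hbij.1 ?_
    rw [map_add, hW, hW₁, hW₂]
    ext <;> simp
  have hX : 0 ≤ WaveDisc.normE Ω T F + √T * WaveDisc.normS Ω g :=
    add_nonneg (Real.sqrt_nonneg _) (mul_nonneg (Real.sqrt_nonneg _) (WaveDisc.normS_nonneg _))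
  have b1 := WaveDisc.normVeh_le_of_first hT hc hR h1 h2 hs hκ.le hsκ hX
    (WaveDisc.abs_loadF_le hT hc hS F hg) hW₁
  have b2 := WaveDisc.normVeh_le_of_second hT hc hR h1 h2 hs hW₂
  have b3 : ‖V₀‖ ≤ CΩ / c₀ * WaveDisc.normS Ω (fun x => c x • gradV₀ x) :=
    hCΩ.norm_le hc₀ hc hcc₀ (p := (V₀, gradV₀)) hV₀
  have b4 : CΩ / c₀ ≤ √((CΩ / c₀) ^ 2 + 4 * T ^ 2) :=
    Real.le_sqrt_of_sq_le (by linarith [sq_nonneg T])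
  have b5 : ‖V₀‖ ≤ √((CΩ / c₀) ^ 2 + 4 * T ^ 2) * WaveDisc.normS Ω (fun x => c x • gradV₀ x) :=
    b3.trans (mul_le_mul_of_nonneg_right b4 (WaveDisc.normS_nonneg _))
  have b6 := mul_le_mul_of_nonneg_left b5 (show 0 ≤ 2 * √T by positivity)
  rw [hsum, ← div_pow]
  refine (WaveDisc.normVeh_add_le hT hc h1 h2 hs W₁ W₂).trans ?_
  linarith
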